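/- **Model.** There are $n$ objects of unit size and a cache that holds exactly $B$ objects. For each object $i$ let $\cdots<T_{i,-1}<T_{i,0}\le 0<T_{i,1}<T_{i,2}<\cdots$ be the random epochs at which it is requested, and let $X_{i,k}=T_{i,k}-T_{i,k-1}$, $k\in\mathbb Z$. Assume that each sequence $\{X_{i,k}\}_{k\in\mathbb Z}$ is stationary and ergodic with finite mean, and that the $n$ processes $\{T_{i,k}\}_{k\in\mathbb Z}$ are mutually independent. Let $\mathcal H_{i,t}$ be the collection of the request epochs of object $i$ before time $t$, under one of the following two conventions (the result holds for each of them): only the epochs in $(0,t)$ are recorded (then, in what follows, $T_{i,0}$ is replaced by $0$ and $X_{i,1}$ by $T_{i,1}$), or all the epochs in $(-\infty,t)$. Let $\mathcal H_t=(\mathcal H_{i,t})_{i\le n}$. Each process is assumed to be regular: for every $k\ge1$, the conditional law of $X_{i,k}$ given the recorded epochs of object $i$ before $T_{i,k}$ is almost surely absolutely continuous. The hazard rate (conditional intensity) of object $i$ at time $t>0$ is, for $T_{i,k-1}<t\le T_{i,k}$ and $k\ge 1$, $$\lambda_i^*(t)=\frac{\frac{d}{dt}P(X_{i,k}<t-T_{i,k-1}\mid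 \text{recorded epochs of } i \text{ before } T_{i,k})}{P(X_{i,k}>t-T_{i,k-1}\mid \text{recorded epochs of } i\text{ before } T_{i,k})}$$ (where the derivative does not exist or the denominator vanishes, an event that has probability zero at request epochs, put $\lambda_i^*(t)=0$). A non-anticipative policy $\pi\in\Pi$ is a measurable map that assigns to $(t,\mathcal H_t)$ the set of the $B$ objects that are cached at time $t$. The hazard-rate rule HR-E caches at each time $t>0$ a set of $B$ objects with the largest values of $\lambda_i^*(t)$; the set is a measurable function of $t$, $\mathcal H_t$ and a random element independent of all the request processes, which serves to break ties. Let $0<T_1<T_2<\cdots$ be the positive request epochs of all the objects together. For $\pi\in\Pi$ and for $\pi=$ HR-E let $H_k^\pi=1$ if the object requested at time $T_k$ is one of those that $\pi$ caches at time $T_k$ on the basis of $\mathcal H_{T_k}$ (which does not contain the request at $T_k$), and $H^\pi_k=0$ otherwise. The stationary hit probability of $\pi$ is the constant $$h^\pi=\lim_{K\to\infty}\frac1K\sum_{k=1}^K H_k^\pi\quad\text{a.s.},$$ whenever this limit exists. **Theorem (Stationary hit probability).** For every non-anticipative policy $\pi\in\Pi$: if $h^{\mathrm{HR\text{-}E}}$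 and $h^\pi$ exist, then $$h^{\mathrm{HR\text{-}E}}\ \ge\ h^{\pi}.$$ Moreover, whether or not these limits exist, $$\liminf_{K\to\infty}\Big(\frac1K\sum_{k=1}^K H_k^{\mathrm{HR\text{-}E}}-\frac1K\sum_{k=1}^K H_k^{\pi}\Big)\ \ge\ 0\quad\text{almost surely.}$$ -/

import Mathlib

open MeasureTheory ProbabilityTheory Filter Topology

/-!
Throughout, `T i k ω` is the epoch of the `k`-th request for object `i` (`i : Fin n`, `k : ℤ`),
with `T i 0 ≤ 0 < T i 1`.
-/

section CacheDefs

/-- Which requests belong to the history before time `t`: those in `(0, t)`, or all those before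
`t` (the infinite past included). -/
inductive HistoryWindow : Type
  | sinceZero
  | wholePast

/-- An epoch as it is recorded in the history: when the history starts at time `0`, an epoch
`≤ 0` is recorded as `0`, so that nothing is known about it. -/
noncomputable def HistoryWindow.record : HistoryWindow → ℝ → ℝ
  | HistoryWindow.sinceZero, t => max t 0
  | HistoryWindow.wholePast, t => t

/-- A joint history: for every object, its recorded epochs, the most recent one first.
(For a history that starts at time `0`, the list is padded with zeros.) -/
abbrev History (n : ℕ) : Type := Fin n → ℕ → ℝ

variable {Ω : Type*} {n : ℕ}

/-- The inter-request times `X_{i,k} = T_{i,k} - T_{i,k-1}`, `k ∈ ℤ`. -/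
def interRequest (T : Fin n → ℤ → Ω → ℝ) (i : Fin n) (k : ℤ) (ω : Ω) : ℝ :=
  T i k ω - T i (k - 1) ω

/-- The process `(Y_k)_{k ∈ ℤ}` is stationary and ergodic: its law on `ℝ^ℤ` is invariant and
ergodic under the shift. -/
def IsStationaryErgodic [MeasurableSpace Ω] (μ : Measure Ω) (Y : ℤ → Ω → ℝ) : Prop :=
  Ergodic (fun (y : ℤ → ℝ) (k : ℤ) => y (k + 1)) (μ.map (fun ω k => Y k ω))

/-- The index `k ≥ 1` with `T_{i,k-1} < t ≤ T_{i,k}`, for `t > 0`. -/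
noncomputable def nextIndex (T : Fin n → ℤ → Ω → ℝ) (i : Fin n) (t : ℝ) (ω : Ω) : ℕ :=
  sInf {k : ℕ | 1 ≤ k ∧ t ≤ T i k ω}

/-- The recorded epochs of object `i` before its `k`-th request, the most recent one first. -/
noncomputable def pastEpochs (w : HistoryWindow) (T : Fin n → ℤ → Ω → ℝ) (i : Fin n) (k : ℕ)
    (ω : Ω) : ℕ → ℝ :=
  fun m => w.record (T i ((k : ℤ) - 1 - (m : ℤ)) ω)

/-- The history `H_t` of all the objects before time `t`. -/
noncomputable def historyBefore (w : HistoryWindow) (T : Fin n → ℤ → Ω → ℝ) (t : ℝ) (ω : Ω) :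
    History n :=
  fun i => pastEpochs w T i (nextIndex T i t ω) ω

/-- The waiting time from the last recorded epoch before the `k`-th request of object `i` to that
request (for a history that starts at time `0` and `k = 1` this is `T_{i,1}`; in all other cases
it is `X_{i,k}`). -/
noncomputable def recordedWait (w : HistoryWindow) (T : Fin n → ℤ → Ω → ℝ) (i : Fin n) (k : ℕ)
    (ω : Ω) : ℝ :=
  w.record (T i k ω) - w.record (T i ((k : ℤ) - 1) ω)

/-- The conditional law of the `k`-th waiting time of object `i` given the past of object `i`. -/
noncomputable def waitLaw [MeasurableSpace Ω] (w : HistoryWindow) (μ : Measure Ω)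
    [IsFiniteMeasure μ] (T : Fin n → ℤ → Ω → ℝ) (i : Fin n) (k : ℕ) (ω : Ω) : Measure ℝ :=
  condDistrib (recordedWait w T i k) (pastEpochs w T i k) μ (pastEpochs w T i k ω)

/-- The request process of object `i` is regular: given the past, each next waiting time has a
density. -/
def IsRegularProcess [MeasurableSpace Ω] (w : HistoryWindow) (μ : Measure Ω) [IsFiniteMeasure μ]
    (T : Fin n → ℤ → Ω → ℝ) (i : Fin n) : Prop :=
  ∀ k : ℕ, 1 ≤ k → ∀ᵐ ω ∂μ, waitLaw w μ T i k ω ≪ volume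

/-- The hazard rate (conditional intensity) `λ*_i(t)` of object `i`: for
`t_{i,k-1} < t ≤ t_{i,k}` it is
`(d/dt P(X_{i,k} < t - t_{i,k-1} | past)) / P(X_{i,k} > t - t_{i,k-1} | past)`. -/
noncomputable def hazardRate [MeasurableSpace Ω] (w : HistoryWindow) (μ : Measure Ω)
    [IsFiniteMeasure μ] (T : Fin n → ℤ → Ω → ℝ) (i : Fin n) (t : ℝ) (ω : Ω) : ℝ :=
  let k := nextIndex T i t ω
  let last := w.record (T i ((k : ℤ) - 1) ω)
  deriv (fun s : ℝ => (waitLaw w μ T i k ω).real (Set.Iio (s - last))) t /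
    (waitLaw w μ T i k ω).real (Set.Ioi (t - last))

/-- The superposition: `requestEpoch T k` is the epoch `T_k` of the `k`-th request (for any
object) after time `0`, `k ≥ 1`. -/
noncomputable def requestEpoch (T : Fin n → ℤ → Ω → ℝ) : ℕ → Ω → ℝ
  | 0, _ => 0
  | k + 1, ω => sInf {t : ℝ | requestEpoch T k ω < t ∧ ∃ i : Fin n, ∃ j : ℕ, 1 ≤ j ∧ T i j ω = t}

/-- A (deterministic, non-anticipative) caching policy: a measurable map that assigns to a time
and a history a set of exactly `B` objects. -/
structure CachingPolicy (n B : ℕ) where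
  cached : ℝ → History n → Finset (Fin n)
  measurable_cached : ∀ S : Finset (Fin n),
    MeasurableSet {p : ℝ × History n | cached p.1 p.2 = S}
  card_cached : ∀ t h, (cached t h).card = B

/-- The cache content `B_k^π` just before the `k`-th request, under a policy. -/
noncomputable def CachingPolicy.content {B : ℕ} (π : CachingPolicy n B) (w : HistoryWindow)
    (T : Fin n → ℤ → Ω → ℝ) (k : ℕ) (ω : Ω) : Finset (Fin n) :=
  π.cached (requestEpoch T k ω) (historyBefore w T (requestEpoch T k ω) ω)

/-- `ρ`, driven by the random element `U` that breaks the ties, is the hazard-rate rule: at every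
time `t > 0` it caches `B` objects whose hazard rates at `t` are the largest. -/
structure IsHazardRateRule [MeasurableSpace Ω] {E : Type*} [MeasurableSpace E]
    (w : HistoryWindow) (μ : Measure Ω) [IsFiniteMeasure μ] (T : Fin n → ℤ → Ω → ℝ) (B : ℕ)
    (U : Ω → E) (ρ : E → ℝ → History n → Finset (Fin n)) : Prop where
  measurable_tie : Measurable U
  /-- The tie-breaking randomness carries no information about the requests. -/
  indep_tie : IndepFun U (fun ω i k => T i k ω) μ
  measurable_rule : ∀ S : Finset (Fin n),
    MeasurableSet {p : E × ℝ × History n | ρ p.1 p.2.1 p.2.2 = S}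
  card_rule : ∀ e t h, (ρ e t h).card = B
  largest : ∀ᵐ ω ∂μ, ∀ t : ℝ, 0 < t →
    ∀ i ∈ ρ (U ω) t (historyBefore w T t ω), ∀ j ∉ ρ (U ω) t (historyBefore w T t ω),
      hazardRate w μ T j t ω ≤ hazardRate w μ T i t ω

/-- The cache content `B_k^{HR-E}` just before the `k`-th request, under the rule `ρ`. -/
noncomputable def ruleContent {E : Type*} (U : Ω → E) (ρ : E → ℝ → History n → Finset (Fin n))
    (w : HistoryWindow) (T : Fin n → ℤ → Ω → ℝ) (k : ℕ) (ω : Ω) : Finset (Fin n) :=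
  ρ (U ω) (requestEpoch T k ω) (historyBefore w T (requestEpoch T k ω) ω)

open scoped Classical in
/-- `H_k`: it is `1` if the object requested at `T_k` is in the cache, and `0` otherwise.
(Under the assumptions of the theorem, simultaneous requests have probability zero.) -/
noncomputable def hit (T : Fin n → ℤ → Ω → ℝ) (C : ℕ → Ω → Finset (Fin n)) (k : ℕ) (ω : Ω) : ℝ :=
  if ∃ i ∈ C k ω, ∃ j : ℕ, 1 ≤ j ∧ T i j ω = requestEpoch T k ω then 1 else 0

/-- `N_K / K`: the fraction of hits among the first `K` requests. -/
noncomputable def hitRatio (T : Fin n → ℤ → Ω → ℝ) (C : ℕ → Ω → Finset (Fin n)) (K : ℕ) (ω : Ω) :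
    ℝ :=
  (∑ k ∈ Finset.Icc 1 K, hit T C k ω) / (K : ℝ)

/-- The stationary hit probability exists and equals `h`. -/
def HasStationaryHitProb [MeasurableSpace Ω] (μ : Measure Ω) (T : Fin n → ℤ → Ω → ℝ)
    (C : ℕ → Ω → Finset (Fin n)) (h : ℝ) : Prop :=
  ∀ᵐ ω ∂μ, Tendsto (fun K : ℕ => hitRatio T C K ω) atTop (𝓝 h)

end CacheDefs

/-!
The hazard-rate rule is optimal at every single request: given everything that happened up to the
`k`-th request of all, and given the tie-breaking element, it has the largest conditional
probability of a hit at request `k + 1`. A strong law for bounded submartingale differences turns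
this into the statement on long-run averages.

*One step.* Let `l i` be the number of requests for object `i` among the first `k` requests. As
long as no further request occurs the history is constant, and the next requests for the different
objects are conditionally independent. By the compensator formula
(`lintegral_eq_lintegral_compensator`), the conditional probability that the next request is for an
object in the cache is the expected integral, from the `k`-th request to the next one, of the sum of
the hazard rates of the cached objects (`lintegral_cachedWhenNext`). Caching the objects with the
largest hazard rates maximizes this integrand at almost every time (`ae_sum_cachedIntensity_le`).
All comparisons are between integrals of nonnegative functions, so that no integrability of hazard
rates is needed. Simultaneous requests need no separate treatment: the hits of the hazard-rate rule
are bounded from below by those in which one object strictly precedes all the others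
(`sum_cachedWhenNext_le_hit`), the hits of the competing policy from above by those in which it
weakly does so (`hit_le_sum_cachedWhenNext`), and the two compensators differ on a set of times of
measure zero.

*The past.* On the event that the counts are `l`, all that happened up to the `k`-th request is a
function of the recorded epochs. This is made explicit by extending the recorded past with
fictitious later requests (`extendPast`) and showing that the first `k` requests, with the histories
and hits at them, are not affected (`AgreeUpTo.hit_eq`, `hasCounts_requestEpoch_iff`).

*Long-run averages.* For the difference `D k` of the hits at request `k + 1` the first step is used
in the form `0 ≤ E [exp (- s (D 0 + ⋯ + D (k - 1))) D k]` for `s ≥ 0`, which involves no conditional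
expectation. It implies `E [exp (- s (D 0 + ⋯ + D (k - 1)))] ≤ exp (k s² / 2)`, and a Chernoff bound
and the Borel-Cantelli lemma conclude (`ae_liminf_average_nonneg`).
-/

/-! ### A strong law for submartingale differences -/

/-- The convexity of `exp` on the chord from `-s` to `s`. -/
theorem exp_neg_mul_le_cosh_sub {s d : ℝ} (hd : |d| ≤ 1) :
    Real.exp (-(s * d)) ≤ Real.cosh s - d * Real.sinh s := by
  obtain ⟨h1, h2⟩ := abs_le.1 hd
  have h := convexOn_exp.2 (Set.mem_univ (-s)) (Set.mem_univ s)
    (show 0 ≤ (1 + d) / 2 by linarith) (show 0 ≤ (1 - d) / 2 by linarith) (by ring)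
  simp only [smul_eq_mul] at h
  rw [Real.cosh_eq, Real.sinh_eq]
  have e : (1 + d) / 2 * -s + (1 - d) / 2 * s = -(s * d) := by ring
  rw [e] at h
  linarith

theorem abs_sum_range_le {Ω : Type*} {D : ℕ → Ω → ℝ} (hD : ∀ k ω, |D k ω| ≤ 1) (k : ℕ) (ω : Ω) :
    |∑ j ∈ Finset.range k, D j ω| ≤ k := by
  calc _ ≤ ∑ j ∈ Finset.range k, |D j ω| := Finset.abs_sum_le_sum_abs _ _
    _ ≤ ∑ j ∈ Finset.range k, (1 : ℝ) := Finset.sum_le_sum fun j _ => hD j ω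
    _ = k := by simp

section Chernoff

variable {Ω : Type*} [MeasurableSpace Ω] {μ : Measure Ω} [IsProbabilityMeasure μ] {D : ℕ → Ω → ℝ}

theorem integrable_exp_neg_mul_sum (hDm : ∀ k, Measurable (D k)) (hD : ∀ k ω, |D k ω| ≤ 1)
    {s : ℝ} (hs : 0 ≤ s) (k : ℕ) :
    Integrable (fun ω => Real.exp (-(s * ∑ j ∈ Finset.range k, D j ω))) μ := by
  refine Integrable.of_bound (C := Real.exp (s * k)) (by fun_prop) (ae_of_all _ fun ω => ?_)
  rw [Real.norm_eq_abs, Real.abs_exp, Real.exp_le_exp]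
  have := (abs_le.1 (abs_sum_range_le hD k ω)).1
  nlinarith

theorem integrable_exp_neg_mul_sum_mul (hDm : ∀ k, Measurable (D k)) (hD : ∀ k ω, |D k ω| ≤ 1)
    {s : ℝ} (hs : 0 ≤ s) (k : ℕ) {f : Ω → ℝ} (hfm : Measurable f) (hf : ∀ ω, |f ω| ≤ 1) :
    Integrable (fun ω => Real.exp (-(s * ∑ j ∈ Finset.range k, D j ω)) * f ω) μ :=
  (integrable_exp_neg_mul_sum hDm hD hs k).mul_bdd (c := 1) hfm.aestronglyMeasurable
    (ae_of_all _ hf)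

theorem integral_exp_neg_mul_sum_le (hDm : ∀ k, Measurable (D k)) (hD : ∀ k ω, |D k ω| ≤ 1)
    {s : ℝ} (hs : 0 ≤ s)
    (h : ∀ k, 0 ≤ ∫ ω, Real.exp (-(s * ∑ j ∈ Finset.range k, D j ω)) * D k ω ∂μ) (k : ℕ) :
    ∫ ω, Real.exp (-(s * ∑ j ∈ Finset.range k, D j ω)) ∂μ ≤ Real.exp (k * (s ^ 2 / 2)) := by
  induction k with
  | zero => simp
  | succ k ih =>
    have i1 := integrable_exp_neg_mul_sum (μ := μ) hDm hD hs k
    have i2 := integrable_exp_neg_mul_sum_mul (μ := μ) hDm hD hs k (hDm k) (hD k)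
    calc ∫ ω, Real.exp (-(s * ∑ j ∈ Finset.range (k + 1), D j ω)) ∂μ
        ≤ ∫ ω, (Real.cosh s * Real.exp (-(s * ∑ j ∈ Finset.range k, D j ω))
            - Real.sinh s * (Real.exp (-(s * ∑ j ∈ Finset.range k, D j ω)) * D k ω)) ∂μ := by
          refine integral_mono (integrable_exp_neg_mul_sum hDm hD hs _)
            ((i1.const_mul _).sub (i2.const_mul _)) fun ω => ?_
          have e := exp_neg_mul_le_cosh_sub (s := s) (hD k ω)
          have p := (Real.exp_pos (-(s * ∑ j ∈ Finset.range k, D j ω))).le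
          simp only [Finset.sum_range_succ, mul_add, neg_add, Real.exp_add]
          nlinarith [mul_le_mul_of_nonneg_left e p]
      _ = Real.cosh s * ∫ ω, Real.exp (-(s * ∑ j ∈ Finset.range k, D j ω)) ∂μ
            - Real.sinh s * ∫ ω, Real.exp (-(s * ∑ j ∈ Finset.range k, D j ω)) * D k ω ∂μ := by
          rw [integral_sub (i1.const_mul _) (i2.const_mul _), integral_const_mul,
            integral_const_mul]
      _ ≤ Real.cosh s * ∫ ω, Real.exp (-(s * ∑ j ∈ Finset.range k, D j ω)) ∂μ := by
          have := mul_nonneg (Real.sinh_nonneg_iff.2 hs) (h k)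
          linarith
      _ ≤ Real.exp (s ^ 2 / 2) * Real.exp (k * (s ^ 2 / 2)) := by
          refine mul_le_mul (Real.cosh_le_exp_half_sq s) ih ?_ (Real.exp_pos _).le
          exact integral_nonneg fun ω => (Real.exp_pos _).le
      _ = Real.exp ((k + 1 : ℕ) * (s ^ 2 / 2)) := by
          rw [← Real.exp_add]; congr 1; push_cast; ring

/-- The Chernoff bound, with the tilt `s = ε` that is optimal for the bound `exp (k s² / 2)` on the
exponential moment. -/
theorem measureReal_sum_le_neg_mul_le (hDm : ∀ k, Measurable (D k)) (hD : ∀ k ω, |D k ω| ≤ 1)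
    (h : ∀ s : ℝ, 0 ≤ s → ∀ k,
      0 ≤ ∫ ω, Real.exp (-(s * ∑ j ∈ Finset.range k, D j ω)) * D k ω ∂μ)
    {ε : ℝ} (hε : 0 ≤ ε) (k : ℕ) :
    μ.real {ω | ∑ j ∈ Finset.range k, D j ω ≤ -(ε * k)} ≤ Real.exp (-(ε ^ 2 / 2)) ^ k := by
  have h1 := mul_meas_ge_le_integral_of_nonneg (μ := μ)
    (ae_of_all _ fun ω => (Real.exp_pos (-(ε * ∑ j ∈ Finset.range k, D j ω))).le)
    (integrable_exp_neg_mul_sum hDm hD hε k) (Real.exp (ε ^ 2 * k))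
  have h2 := integral_exp_neg_mul_sum_le (μ := μ) hDm hD hε (h ε hε) k
  have h3 : μ.real {ω | ∑ j ∈ Finset.range k, D j ω ≤ -(ε * k)} ≤
      μ.real {ω | Real.exp (ε ^ 2 * k) ≤ Real.exp (-(ε * ∑ j ∈ Finset.range k, D j ω))} := by
    refine measureReal_mono fun ω hω => ?_
    simp only [Set.mem_ofPred_eq, Real.exp_le_exp] at hω ⊢
    nlinarith
  rw [← Real.exp_nat_mul]
  have h4 : Real.exp (k * -(ε ^ 2 / 2)) =
      Real.exp (k * (ε ^ 2 / 2)) / Real.exp (ε ^ 2 * k) := by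
    rw [← Real.exp_sub]; congr 1; ring
  rw [h4, le_div_iff₀ (Real.exp_pos _)]
  nlinarith [mul_le_mul_of_nonneg_right h3 (Real.exp_pos (ε ^ 2 * k)).le]

/-- A strong law for submartingale differences: if each bounded increment `D k` has a nonnegative
mean under every exponential tilting by the partial sum of its predecessors, the lower limit of
the averages is nonnegative. The hypothesis gives the Chernoff bound
`P (D 0 + ⋯ + D (k - 1) ≤ - ε k) ≤ exp (- ε² k / 2)`, and the Borel-Cantelli lemma concludes. -/
theorem ae_liminf_average_nonneg (hDm : ∀ k, Measurable (D k)) (hD : ∀ k ω, |D k ω| ≤ 1)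
    (h : ∀ s : ℝ, 0 ≤ s → ∀ k,
      0 ≤ ∫ ω, Real.exp (-(s * ∑ j ∈ Finset.range k, D j ω)) * D k ω ∂μ) :
    ∀ᵐ ω ∂μ, 0 ≤ liminf (fun K : ℕ => (∑ j ∈ Finset.range K, D j ω) / (K : ℝ)) atTop := by
  have key : ∀ q : ℕ, ∀ᵐ ω ∂μ, ∀ᶠ K : ℕ in atTop,
      ω ∉ {ω | ∑ j ∈ Finset.range K, D j ω ≤ -(1 / ((q : ℝ) + 1) * K)} := by
    intro q
    have hq : (0 : ℝ) < 1 / ((q : ℝ) + 1) := by positivity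
    apply ae_eventually_notMem
    have hs : Summable fun k : ℕ => Real.exp (-((1 / ((q : ℝ) + 1)) ^ 2 / 2)) ^ k := by
      refine summable_geometric_of_lt_one (Real.exp_pos _).le ?_
      rw [Real.exp_lt_one_iff]
      have := pow_pos hq 2
      linarith
    have hle : ∀ k : ℕ, μ {ω | ∑ j ∈ Finset.range k, D j ω ≤ -(1 / ((q : ℝ) + 1) * k)} ≤
        ENNReal.ofReal (Real.exp (-((1 / ((q : ℝ) + 1)) ^ 2 / 2)) ^ k) := fun k => by
      rw [← ofReal_measureReal]
      exact ENNReal.ofReal_le_ofReal (measureReal_sum_le_neg_mul_le hDm hD h hq.le k)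
    exact ne_top_of_le_ne_top hs.tsum_ofReal_ne_top (ENNReal.tsum_le_tsum hle)
  filter_upwards [ae_all_iff.2 key] with ω hω
  refine le_of_forall_pos_lt_add fun ε hε => ?_
  obtain ⟨q, hq⟩ := exists_nat_one_div_lt hε
  have hb : ∀ K : ℕ, (∑ j ∈ Finset.range K, D j ω) / (K : ℝ) ≤ 1 := fun K => by
    have := (abs_le.1 (abs_sum_range_le hD K ω)).2
    exact div_le_one_of_le₀ this (Nat.cast_nonneg K)
  have : -(1 / ((q : ℝ) + 1)) ≤
      liminf (fun K : ℕ => (∑ j ∈ Finset.range K, D j ω) / (K : ℝ)) atTop := by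
    refine le_liminf_of_le ?_ ?_
    · exact (isBoundedUnder_of ⟨1, hb⟩ : IsBoundedUnder (· ≤ ·) atTop _).isCoboundedUnder_ge
    · filter_upwards [hω q, eventually_gt_atTop 0] with K hK hK0
      have hK0' : (0 : ℝ) < K := by exact_mod_cast hK0
      rw [le_div_iff₀ hK0']
      simp only [not_le] at hK
      linarith
  linarith

end Chernoff

/-! ### Hazard rates and the compensator of one point -/

section Hazard

/-- A law without atoms does not charge the points at which its survival function vanishes: apart
from the smallest one, these points are covered by null rays with rational end points. -/
theorem measure_setOf_measure_Ioi_eq_zero (ν : Measure ℝ) [NullSingletonClass ν] :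
    ν {s | ν (Set.Ioi s) = 0} = 0 := by
  have hsub : {s | ν (Set.Ioi s) = 0} ⊆
      {s | ν (Set.Ioi s) = 0 ∧ ∀ r, ν (Set.Ioi r) = 0 → s ≤ r} ∪
        ⋃ q : {q : ℚ // ν (Set.Ioi (q : ℝ)) = 0}, Set.Ioi ((q : ℚ) : ℝ) := by
    intro s hs
    by_cases h : ∀ r, ν (Set.Ioi r) = 0 → s ≤ r
    · exact Or.inl ⟨hs, h⟩
    · push Not at h
      obtain ⟨r, hr, hrs⟩ := h
      obtain ⟨q, hq1, hq2⟩ := exists_rat_btwn hrs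
      exact Or.inr (Set.mem_iUnion.2
        ⟨⟨q, measure_mono_null (Set.Ioi_subset_Ioi hq1.le) hr⟩, hq2⟩)
  refine measure_mono_null hsub (measure_union_null ?_ (measure_iUnion_null fun q => q.2))
  refine Set.Subsingleton.measure_zero (fun x hx y hy => ?_) ν
  exact le_antisymm (hx.2 y hy.1) (hy.2 x hx.1)

theorem nullSingletonClass_of_absolutelyContinuous {ν : Measure ℝ}
    (hν : ν ≪ volume) : NullSingletonClass ν :=
  ⟨fun x => hν (measure_singleton x)⟩

/-- The distribution function `s ↦ ν (-∞, s)` of an absolutely continuous law is almost everywhere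
differentiable, with the density as its derivative (here read from the origin `a`). -/
theorem ae_hasDerivAt_measureReal_Iio {ν : Measure ℝ} [IsProbabilityMeasure ν] (hν : ν ≪ volume)
    (a : ℝ) : ∀ᵐ t, HasDerivAt (fun s => ν.real (Set.Iio (s - a)))
      (ν.rnDeriv volume (t - a)).toReal t := by
  have := nullSingletonClass_of_absolutelyContinuous hν
  have h := (cdf ν).ae_hasDerivAt
  rw [measure_cdf] at h
  have h2 := (measurePreserving_sub_right volume a).quasiMeasurePreserving.ae h
  filter_upwards [h2] with t ht
  have e : (fun s => ν.real (Set.Iio (s - a))) = fun s => cdf ν (s - a) := by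
    funext s
    rw [cdf_eq_real, measureReal_congr Iio_ae_eq_Iic]
  rw [e]
  exact ht.comp_sub_const t a

theorem ae_rnDeriv_eq_zero_of_measure_Ioi_eq_zero {ν : Measure ℝ} [IsProbabilityMeasure ν]
    (hν : ν ≪ volume) : ∀ᵐ s, ν (Set.Ioi s) = 0 → ν.rnDeriv volume s = 0 := by
  have := nullSingletonClass_of_absolutelyContinuous hν
  have hm : MeasurableSet {s | ν (Set.Ioi s) = 0} := by
    have ha : Antitone fun s => ν (Set.Ioi s) :=
      fun s r h => measure_mono (Set.Ioi_subset_Ioi h)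
    exact ha.measurable (measurableSet_singleton 0)
  have h := measure_setOf_measure_Ioi_eq_zero ν
  have h1 : ∫⁻ s in {s | ν (Set.Ioi s) = 0}, ν.rnDeriv volume s = 0 :=
    le_antisymm ((Measure.setLIntegral_rnDeriv_le _).trans h.le) bot_le
  rw [setLIntegral_eq_zero_iff hm (Measure.measurable_rnDeriv _ _)] at h1
  exact h1

/-- Integrating against a law and integrating its hazard rate up to the random time agree. The
density is the product of the hazard rate and of the survival function, and the survival function
is the probability that the time is still running. -/
theorem lintegral_eq_lintegral_hazard {ν : Measure ℝ} [IsProbabilityMeasure ν]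
    (hν : ν ≪ volume) (a : ℝ) {φ h : ℝ → ENNReal} (hφ : Measurable φ) (hh : Measurable h)
    (heq : ∀ᵐ t, h t = ENNReal.ofReal (deriv (fun s => ν.real (Set.Iio (s - a))) t /
      ν.real (Set.Ioi (t - a)))) :
    ∫⁻ x, φ (a + x) ∂ν =
      ∫⁻ x, ∫⁻ t, (Set.Iio (a + x)).indicator (fun t => φ t * h t) t ∂volume ∂ν := by
  have hmeas : Measurable fun q : ℝ × ℝ =>
      (Set.Iio (a + q.1)).indicator (fun t => φ t * h t) q.2 := by
    have : (fun q : ℝ × ℝ => (Set.Iio (a + q.1)).indicator (fun t => φ t * h t) q.2) =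
        {q : ℝ × ℝ | q.2 < a + q.1}.indicator fun q => φ q.2 * h q.2 := by
      funext q; simp [Set.indicator]
    rw [this]
    exact ((hφ.comp measurable_snd).mul (hh.comp measurable_snd)).indicator
      (measurableSet_lt measurable_snd (measurable_const.add measurable_fst))
  rw [lintegral_lintegral_swap hmeas.aemeasurable]
  have inner : ∀ t, ∫⁻ x, (Set.Iio (a + x)).indicator (fun t => φ t * h t) t ∂ν =
      φ t * h t * ν (Set.Ioi (t - a)) := fun t => by
    have : (fun x => (Set.Iio (a + x)).indicator (fun t => φ t * h t) t) =
        (Set.Ioi (t - a)).indicator fun _ => φ t * h t := by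
      funext x; simp [Set.indicator, sub_lt_iff_lt_add']
    rw [this, lintegral_indicator_const measurableSet_Ioi]
  simp_rw [inner]
  have hφa : Measurable fun x => φ (a + x) := hφ.comp (measurable_const_add a)
  calc ∫⁻ x, φ (a + x) ∂ν
      = ∫⁻ x, φ (a + x) ∂(volume.withDensity (ν.rnDeriv volume)) := by
        rw [Measure.withDensity_rnDeriv_eq _ _ hν]
    _ = ∫⁻ x, ν.rnDeriv volume x * φ (a + x) := by
        rw [lintegral_withDensity_eq_lintegral_mul _ (Measure.measurable_rnDeriv _ _) hφa]
        rfl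
    _ = ∫⁻ t, ν.rnDeriv volume (t - a) * φ t := by
        rw [← lintegral_sub_right_eq_self (fun x => ν.rnDeriv volume x * φ (a + x)) a]
        simp
    _ = ∫⁻ t, φ t * h t * ν (Set.Ioi (t - a)) := by
        refine lintegral_congr_ae ?_
        have q := (measurePreserving_sub_right (volume : Measure ℝ) a).quasiMeasurePreserving
        filter_upwards [heq, ae_hasDerivAt_measureReal_Iio hν a,
          q.ae (ae_rnDeriv_eq_zero_of_measure_Ioi_eq_zero hν),
          q.ae (Measure.rnDeriv_lt_top ν volume)] with t h1 h2 h3 h4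
        -- where the survival function vanishes, the quotient `h` is the junk value `0`, but the
        -- density vanishes there too
        by_cases h0 : ν (Set.Ioi (t - a)) = 0
        · rw [h0, h3 h0]; simp
        · rw [h1, h2.deriv, measureReal_def, ← ENNReal.toReal_div,
            ENNReal.ofReal_toReal (ENNReal.div_ne_top h4.ne h0), mul_assoc,
            ENNReal.div_mul_cancel h0 (measure_ne_top _ _), mul_comm]

variable {α : Type*} [MeasurableSpace α]

/-- A version of the hazard rate of the law `κ p`, read from the origin `last p`, that is jointly
measurable in `p` and in the time: the derivative is replaced by the upper limit of the difference
quotients with steps `1 / (m + 1)`. -/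
noncomputable def kernelHazard (κ : Kernel α ℝ) (last : α → ℝ) (p : α) (t : ℝ) : ENNReal :=
  ENNReal.ofReal (limsup (fun m : ℕ => ((m : ℝ) + 1) *
    ((κ p).real (Set.Iio (t + 1 / ((m : ℝ) + 1) - last p)) - (κ p).real (Set.Iio (t - last p))))
    atTop / (κ p).real (Set.Ioi (t - last p)))

theorem measurable_kernel_real_Iio (κ : Kernel α ℝ) [IsMarkovKernel κ] :
    Measurable fun q : α × ℝ => (κ q.1).real (Set.Iio q.2) :=
  (Kernel.measurable_kernel_prodMk_left (κ := Kernel.prodMkRight ℝ κ)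
    (measurableSet_lt measurable_snd (measurable_snd.comp measurable_fst) :
      MeasurableSet {q : (α × ℝ) × ℝ | q.2 < q.1.2})).ennreal_toReal

theorem measurable_kernel_real_Ioi (κ : Kernel α ℝ) [IsMarkovKernel κ] :
    Measurable fun q : α × ℝ => (κ q.1).real (Set.Ioi q.2) :=
  (Kernel.measurable_kernel_prodMk_left (κ := Kernel.prodMkRight ℝ κ)
    (measurableSet_lt (measurable_snd.comp measurable_fst) measurable_snd :
      MeasurableSet {q : (α × ℝ) × ℝ | q.1.2 < q.2})).ennreal_toReal

theorem measurable_kernelHazard (κ : Kernel α ℝ) [IsMarkovKernel κ] {last : α → ℝ}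
    (hlast : Measurable last) : Measurable fun q : α × ℝ => kernelHazard κ last q.1 q.2 := by
  have h : ∀ c : ℝ, Measurable fun q : α × ℝ =>
      (κ q.1).real (Set.Iio (q.2 + c - last q.1)) := fun c =>
    (measurable_kernel_real_Iio κ).comp (measurable_fst.prodMk
      ((measurable_snd.add_const c).sub (hlast.comp measurable_fst)))
  refine ENNReal.measurable_ofReal.comp (Measurable.div (Measurable.limsup fun m => ?_) ?_)
  · refine ((h _).sub ?_).const_mul _
    simpa using h 0
  · exact (measurable_kernel_real_Ioi κ).comp (measurable_fst.prodMk
      (measurable_snd.sub (hlast.comp measurable_fst)))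

theorem ae_kernelHazard_eq (κ : Kernel α ℝ) [IsMarkovKernel κ] (last : α → ℝ) {p : α}
    (hp : κ p ≪ volume) :
    ∀ᵐ t, kernelHazard κ last p t =
      ENNReal.ofReal (deriv (fun s => (κ p).real (Set.Iio (s - last p))) t /
        (κ p).real (Set.Ioi (t - last p))) := by
  filter_upwards [ae_hasDerivAt_measureReal_Iio hp (last p)] with t ht
  have hs : Tendsto (fun m : ℕ => 1 / ((m : ℝ) + 1)) atTop (𝓝[≠] 0) :=
    tendsto_nhdsWithin_iff.2 ⟨tendsto_one_div_add_atTop_nhds_zero_nat,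
      Eventually.of_forall fun m => (Nat.one_div_pos_of_nat (n := m)).ne'⟩
  have h := ht.tendsto_slope_zero.comp hs
  rw [kernelHazard, ht.deriv, ← h.limsup_eq]
  simp [Function.comp_def]

/-- The laws `κ p` that are absolutely continuous form a measurable set of `p`, since Lebesgue
measure can be replaced by an equivalent finite measure. Hence absolute continuity almost surely is
the same as absolute continuity almost everywhere under the law of `P`. -/
theorem ae_absolutelyContinuous_map {Ω : Type*} [MeasurableSpace Ω] {μ : Measure Ω}
    (κ : Kernel α ℝ) [IsMarkovKernel κ] {P : Ω → α} (hP : Measurable P)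
    (h : ∀ᵐ ω ∂μ, κ (P ω) ≪ volume) : ∀ᵐ p ∂(μ.map P), κ p ≪ volume := by
  have hm : MeasurableSet {p | κ p ≪ volume} := by
    have h := Kernel.measurableSet_absolutelyContinuous κ
      (Kernel.const α (volume : Measure ℝ).toFinite)
    have e : {p | κ p ≪ volume} =
        {p | κ p ≪ Kernel.const α (volume : Measure ℝ).toFinite p} := by
      ext p
      simp only [Set.mem_ofPred_eq, Kernel.const_apply]
      exact ⟨fun h => h.trans (absolutelyContinuous_toFinite _),
        fun h => h.trans (toFinite_absolutelyContinuous _)⟩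
    rw [e]; exact h
  exact (ae_map_iff hP.aemeasurable hm).2 h

/-- The compensator formula. Given `(Y, P)`, the waiting time `W` has the absolutely continuous
conditional law `condDistrib W P μ`, and so the point `last P + W` has the compensator
`1_{t < last P + W} × (hazard rate at t) dt`: it has the same expected value against every
nonnegative measurable `φ Y P`. -/
theorem lintegral_eq_lintegral_compensator {Ω 𝓨 : Type*} [MeasurableSpace Ω] [MeasurableSpace 𝓨]
    {μ : Measure Ω} [IsProbabilityMeasure μ] {Y : Ω → 𝓨} {P : Ω → α} {W : Ω → ℝ}
    (hY : Measurable Y) (hP : Measurable P) (hW : Measurable W)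
    (hind : IndepFun Y (fun ω => (P ω, W ω)) μ)
    (hac : ∀ᵐ ω ∂μ, condDistrib W P μ (P ω) ≪ volume)
    {last : α → ℝ} (hlast : Measurable last)
    {φ : 𝓨 × α → ℝ → ENNReal} (hφ : Measurable fun q : (𝓨 × α) × ℝ => φ q.1 q.2) :
    ∫⁻ ω, φ (Y ω, P ω) (last (P ω) + W ω) ∂μ =
      ∫⁻ ω, ∫⁻ t, (Set.Iio (last (P ω) + W ω)).indicator
        (fun t => φ (Y ω, P ω) t * kernelHazard (condDistrib W P μ) last (P ω) t) t ∂volume ∂μ := by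
  set κ := condDistrib W P μ with hκ
  have hM : IsMarkovKernel κ := by rw [hκ]; infer_instance
  clear_value κ
  have hlaw : μ.map (fun ω => (Y ω, (P ω, W ω))) = (μ.map Y).prod ((μ.map P) ⊗ₘ κ) := by
    rw [(indepFun_iff_map_prod_eq_prod_map_map hY.aemeasurable
      (hP.prodMk hW).aemeasurable).1 hind, hκ, compProd_map_condDistrib hW.aemeasurable]
  have hpush : ∀ f : 𝓨 × α × ℝ → ENNReal, Measurable f →
      ∫⁻ ω, f (Y ω, P ω, W ω) ∂μ =
        ∫⁻ y, ∫⁻ p, ∫⁻ x, f (y, p, x) ∂(κ p) ∂(μ.map P) ∂(μ.map Y) := by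
    intro f hf
    rw [← lintegral_map hf (hY.prodMk (hP.prodMk hW)), hlaw, lintegral_prod _ hf.aemeasurable]
    refine lintegral_congr fun y => ?_
    exact Measure.lintegral_compProd (hf.comp measurable_prodMk_left)
  have hH := measurable_kernelHazard κ hlast
  have m1 : Measurable fun q : 𝓨 × α × ℝ => φ (q.1, q.2.1) (last q.2.1 + q.2.2) :=
    hφ.comp ((measurable_fst.prodMk (measurable_fst.comp measurable_snd)).prodMk
      ((hlast.comp (measurable_fst.comp measurable_snd)).add
        (measurable_snd.comp measurable_snd)))
  have m2 : Measurable fun q : 𝓨 × α × ℝ => ∫⁻ t, (Set.Iio (last q.2.1 + q.2.2)).indicator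
        (fun t => φ (q.1, q.2.1) t * kernelHazard κ last q.2.1 t) t := by
    have e : (fun r : (𝓨 × α × ℝ) × ℝ => (Set.Iio (last r.1.2.1 + r.1.2.2)).indicator
        (fun t => φ (r.1.1, r.1.2.1) t * kernelHazard κ last r.1.2.1 t) r.2) =
        {r : (𝓨 × α × ℝ) × ℝ | r.2 < last r.1.2.1 + r.1.2.2}.indicator
          fun r => φ (r.1.1, r.1.2.1) r.2 * kernelHazard κ last r.1.2.1 r.2 := by
      funext r; simp [Set.indicator]
    have h1 : Measurable fun r : (𝓨 × α × ℝ) × ℝ => φ (r.1.1, r.1.2.1) r.2 :=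
      hφ.comp (g := fun q : (𝓨 × α) × ℝ => φ q.1 q.2)
        (f := fun r : (𝓨 × α × ℝ) × ℝ => ((r.1.1, r.1.2.1), r.2)) (by fun_prop)
    have h2 : Measurable fun r : (𝓨 × α × ℝ) × ℝ => kernelHazard κ last r.1.2.1 r.2 :=
      hH.comp (g := fun q : α × ℝ => kernelHazard κ last q.1 q.2)
        (f := fun r : (𝓨 × α × ℝ) × ℝ => (r.1.2.1, r.2)) (by fun_prop)
    have h3 : MeasurableSet {r : (𝓨 × α × ℝ) × ℝ | r.2 < last r.1.2.1 + r.1.2.2} :=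
      measurableSet_lt measurable_snd (by fun_prop)
    have h := (h1.mul h2).indicator h3
    refine Measurable.lintegral_prod_right' (f := fun r : (𝓨 × α × ℝ) × ℝ =>
      (Set.Iio (last r.1.2.1 + r.1.2.2)).indicator
        (fun t => φ (r.1.1, r.1.2.1) t * kernelHazard κ last r.1.2.1 t) r.2) ?_
    rw [e]
    exact h
  rw [hpush _ m1, hpush _ m2]
  refine lintegral_congr fun y => lintegral_congr_ae ?_
  filter_upwards [ae_absolutelyContinuous_map κ hP hac] with p hp
  have hφ' : Measurable (φ (y, p)) :=
    hφ.comp (g := fun q : (𝓨 × α) × ℝ => φ q.1 q.2) (f := fun t => ((y, p), t)) (by fun_prop)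
  have hH' : Measurable (kernelHazard κ last p) :=
    hH.comp (g := fun q : α × ℝ => kernelHazard κ last q.1 q.2) (f := fun t => (p, t))
      (by fun_prop)
  exact lintegral_eq_lintegral_hazard hp (last p) hφ' hH' (ae_kernelHazard_eq κ last hp)

end Hazard

/-! ### Trajectories of the requests -/

section Paths

variable {n : ℕ}

/-- A trajectory of all the request processes: `x i k` is the epoch of the `k`-th request for
object `i`. -/
abbrev EpochPath (n : ℕ) : Type := Fin n → ℤ → ℝ

/-- The coordinate process on the space of trajectories. -/
def pathEpoch (i : Fin n) (k : ℤ) (x : EpochPath n) : ℝ := x i k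

/-- The property of a trajectory that the combinatorics of the requests after time `0` uses: for
each object, request `0` is not after time `0`, request `1` is, and the epochs of the requests
`0, 1, 2, …` increase. -/
def IsAdmissiblePath (x : EpochPath n) : Prop :=
  ∀ i, x i 0 ≤ 0 ∧ 0 < x i 1 ∧ StrictMono fun j : ℕ => x i j

/-- Exactly `l i` of the requests `1, 2, …` for object `i` are made by time `r`. -/
def HasCounts (l : Fin n → ℕ) (r : ℝ) (x : EpochPath n) : Prop :=
  ∀ i, x i (l i) ≤ r ∧ r < x i (l i + 1)

/-- The recorded epochs up to the request `l i` for each object `i`. -/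
noncomputable def recordedPast (w : HistoryWindow) (l : Fin n → ℕ) (x : EpochPath n) :
    History n :=
  fun i => pastEpochs w pathEpoch i (l i + 1) x

/-- `H_k` for the rule `f`, as a function of the trajectory. -/
noncomputable def ruleHit (w : HistoryWindow) (f : ℝ → History n → Finset (Fin n)) (k : ℕ)
    (x : EpochPath n) : ℝ :=
  hit pathEpoch (ruleContent (fun _ => ()) (fun _ => f) w pathEpoch) k x

theorem IsAdmissiblePath.pos {x : EpochPath n} (hx : IsAdmissiblePath x) (i : Fin n) {j : ℕ}
    (hj : 1 ≤ j) : 0 < x i j := by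
  have := (hx i).2.2.monotone hj
  have h1 := (hx i).2.1
  simp only [Nat.cast_one] at this
  linarith

theorem IsAdmissiblePath.lt_succ {x : EpochPath n} (hx : IsAdmissiblePath x) (i : Fin n) (j : ℕ) :
    x i j < x i (j + 1) := by
  have := (hx i).2.2 (Nat.lt_succ_self j)
  simpa using this

theorem IsAdmissiblePath.exists_hasCounts {x : EpochPath n} (hx : IsAdmissiblePath x) {r : ℝ}
    (hr : 0 ≤ r) (h : ∀ i, ∃ j : ℕ, r < x i j) : ∃ l, HasCounts l r x := by
  classical
  refine ⟨fun i => Nat.find (h i) - 1, fun i => ?_⟩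
  have h0 : Nat.find (h i) ≠ 0 := fun e => by
    have := Nat.find_spec (h i)
    rw [e] at this
    have h0 := (hx i).1
    simp only [Nat.cast_zero] at this
    linarith
  have h1 := Nat.find_min (h i) (show Nat.find (h i) - 1 < Nat.find (h i) by omega)
  have h2 := Nat.find_spec (h i)
  have e : ((Nat.find (h i) - 1 : ℕ) : ℤ) + 1 = (Nat.find (h i) : ℤ) := by omega
  exact ⟨not_lt.1 h1, by rw [e]; exact h2⟩

theorem HasCounts.lt_index {l : Fin n → ℕ} {r : ℝ} {x : EpochPath n} (hx : IsAdmissiblePath x)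
    (hl : HasCounts l r x) {i : Fin n} {j : ℕ} (h : r < x i j) : l i + 1 ≤ j :=
  (hx i).2.2.lt_iff_lt.1 ((hl i).1.trans_lt h)

theorem HasCounts.index_le {l : Fin n → ℕ} {r : ℝ} {x : EpochPath n} (hx : IsAdmissiblePath x)
    (hl : HasCounts l r x) {i : Fin n} {j : ℕ} (h : x i j ≤ r) : j ≤ l i := by
  have h1 := h.trans_lt (hl i).2
  rw [← Nat.cast_succ] at h1
  exact Nat.lt_succ_iff.1 ((hx i).2.2.lt_iff_lt.1 h1)

theorem HasCounts.unique {l l' : Fin n → ℕ} {r : ℝ} {x : EpochPath n} (hx : IsAdmissiblePath x)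
    (hl : HasCounts l r x) (hl' : HasCounts l' r x) : l = l' :=
  funext fun i => le_antisymm (hl'.index_le hx (hl i).1) (hl.index_le hx (hl' i).1)

theorem IsAdmissiblePath.le_of_index_le {x : EpochPath n} (hx : IsAdmissiblePath x) (i : Fin n)
    {j m : ℕ} (h : j + 1 ≤ m) : x i (j + 1) ≤ x i m := by
  have := (hx i).2.2.monotone h
  simpa using this

theorem HasCounts.exists_isLeast [Nonempty (Fin n)] {l : Fin n → ℕ} {r : ℝ} {x : EpochPath n}
    (hx : IsAdmissiblePath x) (hl : HasCounts l r x) :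
    ∃ i, (∀ j, x i (l i + 1) ≤ x j (l j + 1)) ∧
      IsLeast {t | r < t ∧ ∃ i : Fin n, ∃ j : ℕ, 1 ≤ j ∧ pathEpoch i j x = t} (x i (l i + 1)) := by
  obtain ⟨i, hi⟩ := Finite.exists_min fun i => x i (l i + 1)
  refine ⟨i, hi, ⟨(hl i).2, i, l i + 1, by omega, by simp [pathEpoch]⟩, ?_⟩
  rintro t ⟨hrt, j, m, -, rfl⟩
  exact (hi j).trans (hx.le_of_index_le j (hl.lt_index hx hrt))

/-- The `(k + 1)`-th request for each object comes after the `k`-th request of all. In particular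
there always is a next request, even if the epochs accumulate. -/
theorem requestEpoch_bounds [Nonempty (Fin n)] {x : EpochPath n} (hx : IsAdmissiblePath x)
    (k : ℕ) : 0 ≤ requestEpoch pathEpoch k x ∧ ∀ i, requestEpoch pathEpoch k x < x i (k + 1) := by
  induction k with
  | zero => exact ⟨le_rfl, fun i => by simpa [requestEpoch] using (hx i).2.1⟩
  | succ k ih =>
    obtain ⟨l, hl⟩ := hx.exists_hasCounts ih.1 fun i => ⟨k + 1, by simpa using ih.2 i⟩
    obtain ⟨i, -, hleast⟩ := hl.exists_isLeast hx
    have e : requestEpoch pathEpoch (k + 1) x = x i (l i + 1) := hleast.csInf_eq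
    refine ⟨e ▸ ih.1.trans (hl i).2.le, fun j => ?_⟩
    have h1 : x i (l i + 1) ≤ x j (k + 1) :=
      hleast.2 ⟨ih.2 j, j, k + 1, by omega, by simp [pathEpoch]⟩
    have h2 := hx.lt_succ j (k + 1)
    rw [e]
    exact h1.trans_lt (by simpa using h2)

theorem exists_hasCounts_requestEpoch [Nonempty (Fin n)] {x : EpochPath n}
    (hx : IsAdmissiblePath x) (k : ℕ) : ∃ l, HasCounts l (requestEpoch pathEpoch k x) x :=
  hx.exists_hasCounts (requestEpoch_bounds hx k).1 fun i =>
    ⟨k + 1, by simpa using (requestEpoch_bounds hx k).2 i⟩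

theorem isLeast_requestEpoch [Nonempty (Fin n)] {x : EpochPath n}
    (hx : IsAdmissiblePath x) (k : ℕ) :
    IsLeast {t | requestEpoch pathEpoch k x < t ∧
      ∃ i : Fin n, ∃ j : ℕ, 1 ≤ j ∧ pathEpoch i j x = t} (requestEpoch pathEpoch (k + 1) x) := by
  obtain ⟨l, hl⟩ := exists_hasCounts_requestEpoch hx k
  obtain ⟨i, -, h⟩ := hl.exists_isLeast hx
  have e : requestEpoch pathEpoch (k + 1) x = x i (l i + 1) := h.csInf_eq
  rw [e]
  exact h

theorem strictMono_requestEpoch [Nonempty (Fin n)] {x : EpochPath n} (hx : IsAdmissiblePath x) :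
    StrictMono fun k => requestEpoch pathEpoch k x :=
  strictMono_nat_of_lt_succ fun k => (isLeast_requestEpoch hx k).1.1

/-- The next request is for the object whose first pending request is the earliest. -/
theorem HasCounts.requestEpoch_succ [Nonempty (Fin n)] {l : Fin n → ℕ} {x : EpochPath n}
    (hx : IsAdmissiblePath x) {k : ℕ} (hl : HasCounts l (requestEpoch pathEpoch k x) x) :
    ∃ i, (∀ j, x i (l i + 1) ≤ x j (l j + 1)) ∧
      requestEpoch pathEpoch (k + 1) x = x i (l i + 1) := by
  obtain ⟨i, hi, h⟩ := hl.exists_isLeast hx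
  exact ⟨i, hi, h.csInf_eq⟩

theorem HasCounts.nextIndex_eq {l : Fin n → ℕ} {r t : ℝ} {x : EpochPath n}
    (hx : IsAdmissiblePath x) (hl : HasCounts l r x) (hrt : r < t) {i : Fin n}
    (ht : t ≤ x i (l i + 1)) : nextIndex pathEpoch i t x = l i + 1 := by
  refine IsLeast.csInf_eq ⟨⟨by omega, by simpa [pathEpoch] using ht⟩, ?_⟩
  rintro m ⟨-, hm⟩
  exact hl.lt_index hx (hrt.trans_le hm)

/-- Between two successive requests the history does not change. -/
theorem HasCounts.historyBefore_eq {l : Fin n → ℕ} {r t : ℝ} {x : EpochPath n}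
    (hx : IsAdmissiblePath x) (hl : HasCounts l r x) (w : HistoryWindow) (hrt : r < t)
    (ht : ∀ i, t ≤ x i (l i + 1)) : historyBefore w pathEpoch t x = recordedPast w l x := by
  funext i
  simp only [historyBefore, recordedPast, hl.nextIndex_eq hx hrt (ht i)]

theorem HistoryWindow.record_le_iff (w : HistoryWindow) {s t : ℝ} (hs : 0 ≤ s) :
    w.record t ≤ s ↔ t ≤ s := by
  cases w <;> simp [HistoryWindow.record, hs]

theorem HistoryWindow.record_of_nonneg (w : HistoryWindow) {t : ℝ} (ht : 0 ≤ t) :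
    w.record t = t := by
  cases w <;> simp [HistoryWindow.record, ht]

theorem HistoryWindow.record_record (w : HistoryWindow) (t : ℝ) :
    w.record (w.record t) = w.record t := by
  cases w <;> simp [HistoryWindow.record]

theorem HistoryWindow.measurable_record (w : HistoryWindow) : Measurable w.record := by
  cases w
  · exact measurable_id.max measurable_const
  · exact measurable_id

/-- The trajectories `x` and `y` have the same recorded requests up to time `s`, namely those with
index at most `l i`. -/
def AgreeUpTo (w : HistoryWindow) (l : Fin n → ℕ) (s : ℝ) (x y : EpochPath n) : Prop :=
  ∀ i, (∀ j : ℤ, j ≤ l i → w.record (x i j) = w.record (y i j)) ∧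
    (∀ j : ℕ, 1 ≤ j → j ≤ l i → x i j = y i j) ∧
    ∀ j : ℕ, l i < j → s < x i j ∧ s < y i j

theorem AgreeUpTo.historyBefore_eq {w : HistoryWindow} {l : Fin n → ℕ} {x y : EpochPath n}
    {s t : ℝ} (h : AgreeUpTo w l s x y) (ht : t ≤ s) :
    historyBefore w pathEpoch t y = historyBefore w pathEpoch t x := by
  have e : ∀ i, nextIndex pathEpoch i t y = nextIndex pathEpoch i t x := fun i => by
    have : {m : ℕ | 1 ≤ m ∧ t ≤ pathEpoch i m y} = {m : ℕ | 1 ≤ m ∧ t ≤ pathEpoch i m x} := by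
      ext m
      simp only [Set.mem_ofPred_eq, pathEpoch]
      refine and_congr_right fun hm => ?_
      by_cases hc : m ≤ l i
      · rw [(h i).2.1 m hm hc]
      · have := (h i).2.2 m (by omega)
        exact ⟨fun _ => ht.trans this.1.le, fun _ => ht.trans this.2.le⟩
    simp only [nextIndex, this]
  have hle : ∀ i, nextIndex pathEpoch i t x ≤ l i + 1 := fun i =>
    Nat.sInf_le ⟨by omega, ht.trans ((h i).2.2 (l i + 1) (by omega)).1.le⟩
  funext i m
  simp only [historyBefore, pastEpochs, e]
  have := hle i
  exact ((h i).1 _ (by omega)).symm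

section Locality

variable [Nonempty (Fin n)] {w : HistoryWindow} {l : Fin n → ℕ} {x y : EpochPath n} {k : ℕ}

theorem AgreeUpTo.requestEpoch_eq (hx : IsAdmissiblePath x)
    (h : AgreeUpTo w l (requestEpoch pathEpoch k x) x y) :
    ∀ m, m ≤ k → requestEpoch pathEpoch m y = requestEpoch pathEpoch m x := by
  intro m
  induction m with
  | zero => intro _; rfl
  | succ m ih =>
    intro hm
    have e := ih (by omega)
    have hs : requestEpoch pathEpoch (m + 1) x ≤ requestEpoch pathEpoch k x :=
      (strictMono_requestEpoch hx).monotone hm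
    obtain ⟨⟨h1, i, j, hj, hij⟩, h2⟩ := isLeast_requestEpoch hx m
    refine IsLeast.csInf_eq ⟨⟨e ▸ h1, i, j, hj, ?_⟩, ?_⟩
    · have hjl : j ≤ l i := by
        by_contra hc
        have h3 := ((h i).2.2 j (by omega)).1
        have h4 : x i j = requestEpoch pathEpoch (m + 1) x := hij
        linarith
      rw [← hij]
      exact ((h i).2.1 j hj hjl).symm
    · rintro t ⟨ht, i', j', hj', rfl⟩
      by_cases hc : j' ≤ l i'
      · have h3 : pathEpoch i' j' y = pathEpoch i' j' x := ((h i').2.1 j' hj' hc).symm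
        rw [h3] at ht ⊢
        exact h2 ⟨e ▸ ht, i', j', hj', rfl⟩
      · exact hs.trans ((h i').2.2 j' (by omega)).2.le

/-- The hits up to the `k`-th request depend on nothing after that request. -/
theorem AgreeUpTo.hit_eq (hx : IsAdmissiblePath x)
    (h : AgreeUpTo w l (requestEpoch pathEpoch k x) x y)
    (f : ℝ → History n → Finset (Fin n)) {m : ℕ} (hm : m ≤ k) :
    ruleHit w f m y = ruleHit w f m x := by
  have e := h.requestEpoch_eq hx m hm
  have hs : requestEpoch pathEpoch m x ≤ requestEpoch pathEpoch k x :=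
    (strictMono_requestEpoch hx).monotone hm
  have e2 : ∀ i, (∃ j : ℕ, 1 ≤ j ∧ pathEpoch i j y = requestEpoch pathEpoch m x) ↔
      ∃ j : ℕ, 1 ≤ j ∧ pathEpoch i j x = requestEpoch pathEpoch m x := fun i => by
    refine exists_congr fun j => and_congr_right fun hj => ?_
    simp only [pathEpoch]
    by_cases hc : j ≤ l i
    · rw [(h i).2.1 j hj hc]
    · have := (h i).2.2 j (by omega)
      exact ⟨fun h => by linarith, fun h => by linarith⟩
  have e3 := h.historyBefore_eq hs
  classical
  unfold ruleHit hit
  refine if_congr ?_ rfl rfl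
  simp only [ruleContent]
  rw [e, e3]
  simp only [e2]

end Locality

/-- A trajectory with a given recorded past `p` up to the requests `l`; the later requests are
fictitious, at unit distance from each other and after the whole of the past (the sum of the
`|p m 0|` bounds the last recorded epochs of all the objects). -/
noncomputable def extendPast (l : Fin n → ℕ) (p : History n) : EpochPath n :=
  fun i j => if j ≤ l i then p i (l i - j).toNat else (∑ m, |p m 0|) + ((j : ℝ) - l i)

section Extend

variable {w : HistoryWindow} {l : Fin n → ℕ} {x : EpochPath n}

theorem recordedPast_zero (i : Fin n) : recordedPast w l x i 0 = w.record (x i (l i)) := by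
  simp [recordedPast, pastEpochs, pathEpoch]

theorem extendPast_of_le {i : Fin n} {j : ℤ} (hj : j ≤ l i) :
    extendPast l (recordedPast w l x) i j = w.record (x i j) := by
  simp only [extendPast, if_pos hj, recordedPast, pastEpochs, pathEpoch]
  congr 2
  push_cast
  omega

theorem extendPast_of_lt {p : History n} {i : Fin n} {j : ℤ} (hj : l i < j) :
    extendPast l p i j = (∑ m, |p m 0|) + ((j : ℝ) - l i) := by
  simp only [extendPast, if_neg (not_le.2 hj)]

theorem le_sum_abs (p : History n) (i : Fin n) : p i 0 ≤ ∑ m, |p m 0| :=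
  (le_abs_self _).trans
    (Finset.single_le_sum (f := fun m => |p m 0|) (fun _ _ => abs_nonneg _) (Finset.mem_univ i))

theorem sum_abs_lt_extendPast {p : History n} {i : Fin n} {j : ℤ} (hj : l i < j) :
    ∑ m, |p m 0| < extendPast l p i j := by
  rw [extendPast_of_lt hj]
  have : ((l i : ℤ) : ℝ) < (j : ℝ) := by exact_mod_cast hj
  push_cast at this
  linarith

theorem IsAdmissiblePath.extendPast (hx : IsAdmissiblePath x) :
    IsAdmissiblePath (extendPast l (recordedPast w l x)) := by
  have h0 : ∀ i, w.record (x i 0) ≤ 0 := fun i => (w.record_le_iff le_rfl).2 (hx i).1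
  have hnn : 0 ≤ ∑ m, |recordedPast w l x m 0| := Finset.sum_nonneg fun _ _ => abs_nonneg _
  intro i
  refine ⟨?_, ?_, strictMono_nat_of_lt_succ fun j => ?_⟩
  · rw [extendPast_of_le (by omega)]; exact h0 i
  · by_cases h : (1 : ℤ) ≤ l i
    · rw [extendPast_of_le h, w.record_of_nonneg (hx i).2.1.le]
      exact (hx i).2.1
    · exact hnn.trans_lt (sum_abs_lt_extendPast (by omega))
  · rcases lt_trichotomy j (l i) with h | h | h
    · rw [extendPast_of_le (by omega), extendPast_of_le (by omega),
        w.record_of_nonneg (hx.pos i (Nat.le_add_left 1 j)).le]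
      rcases Nat.eq_zero_or_pos j with h' | h'
      · subst h'
        exact (h0 i).trans_lt (hx.pos i le_rfl)
      · rw [w.record_of_nonneg (hx.pos i h').le]
        exact (hx i).2.2 (Nat.lt_succ_self j)
    · refine lt_of_le_of_lt ?_ (sum_abs_lt_extendPast (by omega))
      rw [extendPast_of_le (by omega), h, ← recordedPast_zero]
      exact le_sum_abs _ i
    · rw [extendPast_of_lt (by omega), extendPast_of_lt (by omega)]
      push_cast
      linarith

theorem agreeUpTo_extendPast (hx : IsAdmissiblePath x) {s : ℝ}
    (h1 : ∀ i, s < x i (l i + 1)) (h2 : ∀ i (j : ℕ), l i < j →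
      s < extendPast l (recordedPast w l x) i j) :
    AgreeUpTo w l s x (extendPast l (recordedPast w l x)) := by
  refine fun i => ⟨fun j hj => ?_, fun j hj1 hj => ?_, fun j hj =>
    ⟨(h1 i).trans_le (hx.le_of_index_le i hj), h2 i j hj⟩⟩
  · rw [extendPast_of_le hj, w.record_record]
  · rw [extendPast_of_le (by omega), w.record_of_nonneg (hx.pos i hj1).le]

theorem AgreeUpTo.symm {y : EpochPath n} {s : ℝ} (h : AgreeUpTo w l s x y) :
    AgreeUpTo w l s y x := fun i =>
  ⟨fun j hj => ((h i).1 j hj).symm, fun j h1 h2 => ((h i).2.1 j h1 h2).symm,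
    fun j hj => ((h i).2.2 j hj).symm⟩

variable [Nonempty (Fin n)] {k : ℕ}

/-- The `k`-th request belongs to the recorded past (for `k = 0` it is the time origin). -/
theorem HasCounts.requestEpoch_le_sum_abs (hx : IsAdmissiblePath x)
    (hl : HasCounts l (requestEpoch pathEpoch k x) x) :
    requestEpoch pathEpoch k x ≤ ∑ m, |recordedPast w l x m 0| := by
  cases k with
  | zero => exact Finset.sum_nonneg fun _ _ => abs_nonneg _
  | succ k =>
    obtain ⟨-, i, j, hj, hij⟩ := (isLeast_requestEpoch hx k).1
    have hij' : x i j = requestEpoch pathEpoch (k + 1) x := hij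
    have hjl := hl.index_le hx hij'.le
    rw [← hij']
    have h1 : x i j ≤ x i (l i) := (hx i).2.2.monotone hjl
    refine le_trans ?_ (le_sum_abs _ i)
    rw [recordedPast_zero, w.record_of_nonneg (hx.pos i (hj.trans hjl)).le]
    exact h1

theorem HasCounts.agreeUpTo_extendPast (hx : IsAdmissiblePath x)
    (hl : HasCounts l (requestEpoch pathEpoch k x) x) :
    AgreeUpTo w l (requestEpoch pathEpoch k x) x (extendPast l (recordedPast w l x)) :=
  _root_.agreeUpTo_extendPast hx (fun i => (hl i).2) fun i j hj =>
    (hl.requestEpoch_le_sum_abs hx).trans_lt (sum_abs_lt_extendPast (by omega))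

/-- The event that `l` lists the numbers of requests made by the `k`-th request of all. It is an
event about the recorded past up to the requests `l`, intersected with the event that the next
request for each object comes later than the `k`-th request of that past. -/
theorem hasCounts_requestEpoch_iff (hx : IsAdmissiblePath x) :
    HasCounts l (requestEpoch pathEpoch k x) x ↔
      (HasCounts l (requestEpoch pathEpoch k (extendPast l (recordedPast w l x)))
          (extendPast l (recordedPast w l x)) ∧
        ∀ i, requestEpoch pathEpoch k (extendPast l (recordedPast w l x)) < x i (l i + 1)) := by
  have hy : IsAdmissiblePath (_root_.extendPast l (recordedPast w l x)) := hx.extendPast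
  have hrec : ∀ i, _root_.extendPast l (recordedPast w l x) i (l i) = w.record (x i (l i)) :=
    fun i => extendPast_of_le le_rfl
  constructor
  · intro hl
    have ha := hl.agreeUpTo_extendPast (w := w) hx
    have e := ha.requestEpoch_eq hx k le_rfl
    rw [e]
    refine ⟨fun i => ⟨?_, ?_⟩, fun i => (hl i).2⟩
    · rw [hrec, w.record_le_iff (requestEpoch_bounds hx k).1]
      exact (hl i).1
    · exact ((ha i).2.2 (l i + 1) (by omega)).2
  · rintro ⟨hl, h⟩
    have ha := _root_.agreeUpTo_extendPast (w := w) hx h fun i j hj =>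
      (hl i).2.trans_le (hy.le_of_index_le i hj)
    have e := ha.symm.requestEpoch_eq hy k le_rfl
    rw [e]
    refine fun i => ⟨?_, h i⟩
    have h1 := (hl i).1
    rwa [hrec, w.record_le_iff (requestEpoch_bounds hy k).1] at h1

end Extend

end Paths

/-! ### Measurability on the space of trajectories -/

section Measurability

variable {n : ℕ}

/-- The first point after `r` of a countable family of random points is measurable. If there is no
such point, the infimum has the junk value `0`, which the proof takes into account. -/
theorem measurable_sInf_gt {X ι : Type*} [MeasurableSpace X] [Countable ι] {r : X → ℝ}
    {f : ι → X → ℝ} (hr : Measurable r) (hf : ∀ p, Measurable (f p)) :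
    Measurable fun x => sInf {t | r x < t ∧ ∃ p, f p x = t} := by
  refine measurable_of_Iio fun c => ?_
  have e : (fun x => sInf {t | r x < t ∧ ∃ p, f p x = t}) ⁻¹' Set.Iio c =
      (⋃ p, {x | r x < f p x} ∩ {x | f p x < c}) ∪
        ((⋂ p, {x | f p x ≤ r x}) ∩ {_x | 0 < c}) := by
    ext x
    simp only [Set.mem_preimage, Set.mem_Iio, Set.mem_union, Set.mem_iUnion, Set.mem_inter_iff,
      Set.mem_ofPred_eq, Set.mem_iInter]
    have hb : BddBelow {t | r x < t ∧ ∃ p, f p x = t} := ⟨r x, fun t ht => ht.1.le⟩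
    by_cases hne : ∃ p, r x < f p x
    · obtain ⟨p, hp⟩ := hne
      rw [csInf_lt_iff hb ⟨f p x, hp, p, rfl⟩]
      constructor
      · rintro ⟨t, ⟨h1, q, rfl⟩, h2⟩
        exact Or.inl ⟨q, h1, h2⟩
      · rintro (⟨q, h1, h2⟩ | ⟨h, -⟩)
        · exact ⟨_, ⟨h1, q, rfl⟩, h2⟩
        · exact absurd hp (not_lt.2 (h p))
    · push Not at hne
      have he : {t | r x < t ∧ ∃ p, f p x = t} = ∅ := by
        ext t
        simp only [Set.mem_ofPred_eq, Set.mem_empty_iff_false, iff_false]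
        rintro ⟨h1, p, rfl⟩
        exact absurd h1 (not_lt.2 (hne p))
      rw [he, Real.sInf_empty]
      constructor
      · exact fun h => Or.inr ⟨hne, h⟩
      · rintro (⟨q, h1, -⟩ | ⟨-, h⟩)
        · exact absurd h1 (not_lt.2 (hne q))
        · exact h
  rw [e]
  refine (MeasurableSet.iUnion fun p => ?_).union
    ((MeasurableSet.iInter fun p => ?_).inter (MeasurableSet.const _))
  · exact (measurableSet_lt hr (hf p)).inter (measurableSet_lt (hf p) measurable_const)
  · exact measurableSet_le (hf p) hr

/-- The first index with a property is measurable; it is `0` by convention if no index has it. -/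
theorem measurable_nat_sInf {X : Type*} [MeasurableSpace X] {P : ℕ → X → Prop}
    (hP : ∀ m, MeasurableSet {x | P m x}) : Measurable fun x => sInf {m | P m x} := by
  refine measurable_to_countable' fun m => ?_
  have e : (fun x => sInf {m | P m x}) ⁻¹' {m} =
      (({x | P m x} ∩ ⋂ j : Fin m, {x | P j x}ᶜ) ∪ ((⋂ j, {x | P j x}ᶜ) ∩ {_x | m = 0})) := by
    ext x
    simp only [Set.mem_preimage, Set.mem_singleton_iff, Set.mem_union, Set.mem_inter_iff,
      Set.mem_iInter, Set.mem_ofPred_eq, Set.mem_compl_iff]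
    by_cases hne : ∃ j, P j x
    · constructor
      · rintro rfl
        exact Or.inl ⟨Nat.sInf_mem (s := {m | P m x}) hne, fun j => Nat.notMem_of_lt_sInf j.2⟩
      · rintro (⟨h1, h2⟩ | ⟨h, -⟩)
        · refine IsLeast.csInf_eq ⟨h1, fun j hj => ?_⟩
          by_contra hc
          exact h2 ⟨j, not_le.1 hc⟩ hj
        · obtain ⟨j, hj⟩ := hne
          exact absurd hj (h j)
    · push Not at hne
      have he : {m | P m x} = ∅ := by
        ext j; simpa using hne j
      rw [he, Nat.sInf_empty]
      constructor
      · rintro rfl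
        exact Or.inr ⟨hne, rfl⟩
      · rintro (⟨h, -⟩ | ⟨-, h⟩)
        · exact absurd h (hne m)
        · exact h.symm
  rw [e]
  exact ((hP m).inter (MeasurableSet.iInter fun j : Fin m => (hP j).compl)).union
    ((MeasurableSet.iInter fun j => (hP j).compl).inter (MeasurableSet.const _))

theorem measurable_pathEpoch (i : Fin n) (j : ℤ) :
    Measurable (pathEpoch i j : EpochPath n → ℝ) :=
  (measurable_pi_apply j).comp (measurable_pi_apply i)

theorem measurable_requestEpoch (k : ℕ) :
    Measurable (requestEpoch pathEpoch k : EpochPath n → ℝ) := by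
  induction k with
  | zero => exact measurable_const
  | succ k ih =>
    have h := measurable_sInf_gt (ι := Fin n × {j : ℕ // 1 ≤ j}) ih
      (fun p => measurable_pathEpoch p.1 (p.2 : ℕ))
    simpa [requestEpoch, Prod.exists, Subtype.exists] using h

theorem measurable_nextIndex (i : Fin n) :
    Measurable fun q : ℝ × EpochPath n => nextIndex pathEpoch i q.1 q.2 := by
  refine measurable_nat_sInf fun m => ?_
  exact (MeasurableSet.const _).inter
    (measurableSet_le measurable_fst ((measurable_pathEpoch i m).comp measurable_snd))

theorem measurable_historyBefore (w : HistoryWindow) :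
    Measurable fun q : ℝ × EpochPath n => historyBefore w pathEpoch q.1 q.2 := by
  refine measurable_pi_iff.2 fun i => measurable_pi_iff.2 fun m => ?_
  have h : Measurable fun q : ℕ × EpochPath n => pastEpochs w pathEpoch i q.1 q.2 m :=
    measurable_from_prod_countable_right fun k =>
      w.measurable_record.comp (measurable_pathEpoch i ((k : ℤ) - 1 - m))
  exact h.comp ((measurable_nextIndex i).prodMk measurable_snd)

theorem measurable_recordedPast (w : HistoryWindow) (l : Fin n → ℕ) :
    Measurable (recordedPast w l : EpochPath n → History n) :=
  measurable_pi_iff.2 fun i => measurable_pi_iff.2 fun _ =>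
    w.measurable_record.comp (measurable_pathEpoch i _)

theorem measurable_extendPast (l : Fin n → ℕ) :
    Measurable (extendPast l : History n → EpochPath n) := by
  refine measurable_pi_iff.2 fun i => measurable_pi_iff.2 fun j => ?_
  by_cases h : j ≤ l i
  · simp only [extendPast, if_pos h]
    fun_prop
  · simp only [extendPast, if_neg h]
    fun_prop

theorem measurableSet_hasCounts (l : Fin n → ℕ) (k : ℕ) :
    MeasurableSet {x : EpochPath n | HasCounts l (requestEpoch pathEpoch k x) x} := by
  have e : {x : EpochPath n | HasCounts l (requestEpoch pathEpoch k x) x} =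
      ⋂ i, ({x | pathEpoch i (l i) x ≤ requestEpoch pathEpoch k x} ∩
        {x | requestEpoch pathEpoch k x < pathEpoch i (l i + 1) x}) := by
    ext x; simp [HasCounts, pathEpoch]
  rw [e]
  exact MeasurableSet.iInter fun i =>
    (measurableSet_le (measurable_pathEpoch i _) (measurable_requestEpoch k)).inter
      (measurableSet_lt (measurable_requestEpoch k) (measurable_pathEpoch i _))

variable {E : Type*} [MeasurableSpace E] {ρ : E → ℝ → History n → Finset (Fin n)}

theorem measurableSet_mem_rule
    (hρ : ∀ S : Finset (Fin n), MeasurableSet {p : E × ℝ × History n | ρ p.1 p.2.1 p.2.2 = S})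
    (i : Fin n) : MeasurableSet {p : E × ℝ × History n | i ∈ ρ p.1 p.2.1 p.2.2} := by
  have e : {p : E × ℝ × History n | i ∈ ρ p.1 p.2.1 p.2.2} =
      ⋃ S : {S : Finset (Fin n) // i ∈ S}, {p | ρ p.1 p.2.1 p.2.2 = S} := by
    ext p; simp
  rw [e]
  exact MeasurableSet.iUnion fun S => hρ S

theorem measurable_ruleHit
    (hρ : ∀ S : Finset (Fin n), MeasurableSet {p : E × ℝ × History n | ρ p.1 p.2.1 p.2.2 = S})
    (w : HistoryWindow) (k : ℕ) :
    Measurable fun q : E × EpochPath n => ruleHit w (ρ q.1) k q.2 := by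
  classical
  unfold ruleHit hit
  refine Measurable.ite ?_ measurable_const measurable_const
  have e : {q : E × EpochPath n |
      ∃ i ∈ ruleContent (fun _ => ()) (fun _ => ρ q.1) w pathEpoch k q.2,
        ∃ j : ℕ, 1 ≤ j ∧ pathEpoch i j q.2 = requestEpoch pathEpoch k q.2} =
      ⋃ i, ((fun q : E × EpochPath n => (q.1, requestEpoch pathEpoch k q.2,
          historyBefore w pathEpoch (requestEpoch pathEpoch k q.2) q.2)) ⁻¹'
            {p | i ∈ ρ p.1 p.2.1 p.2.2} ∩
        ⋃ j : {j : ℕ // 1 ≤ j}, {q | pathEpoch i (j : ℕ) q.2 = requestEpoch pathEpoch k q.2}) := by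
    ext q; simp [ruleContent]
  rw [e]
  have hr : Measurable fun q : E × EpochPath n => requestEpoch pathEpoch k q.2 :=
    (measurable_requestEpoch k).comp measurable_snd
  have hh : Measurable fun q : E × EpochPath n => (q.1, requestEpoch pathEpoch k q.2,
      historyBefore w pathEpoch (requestEpoch pathEpoch k q.2) q.2) := by
    have h1 : Measurable fun q : E × EpochPath n => (requestEpoch pathEpoch k q.2, q.2) :=
      hr.prodMk measurable_snd
    have h2 : Measurable fun q : E × EpochPath n =>
        historyBefore w pathEpoch (requestEpoch pathEpoch k q.2) q.2 :=
      Measurable.comp (g := fun q : ℝ × EpochPath n => historyBefore w pathEpoch q.1 q.2)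
        (f := fun q : E × EpochPath n => (requestEpoch pathEpoch k q.2, q.2))
        (measurable_historyBefore w) h1
    exact measurable_fst.prodMk (hr.prodMk h2)
  refine MeasurableSet.iUnion fun i => MeasurableSet.inter ?_ (MeasurableSet.iUnion fun j => ?_)
  · exact hh (measurableSet_mem_rule hρ i)
  · have h3 : Measurable fun q : E × EpochPath n => pathEpoch i (j : ℕ) q.2 :=
      (measurable_pathEpoch i _).comp measurable_snd
    exact measurableSet_eq_fun h3 hr

end Measurability

section Transfer

variable {Ω : Type*} {n : ℕ} (T : Fin n → ℤ → Ω → ℝ)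

theorem requestEpoch_eq_pathEpoch (k : ℕ) (ω : Ω) :
    requestEpoch T k ω = requestEpoch pathEpoch k (fun i j => T i j ω) := by
  induction k with
  | zero => rfl
  | succ k ih => simp only [requestEpoch, ih]; rfl

theorem hit_eq_ruleHit {E : Type*} (U : Ω → E) (ρ : E → ℝ → History n → Finset (Fin n))
    (w : HistoryWindow) (k : ℕ) (ω : Ω) :
    hit T (ruleContent U ρ w T) k ω = ruleHit w (ρ (U ω)) k (fun i j => T i j ω) := by
  have h : ∀ t, historyBefore w T t ω = historyBefore w pathEpoch t (fun i j => T i j ω) :=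
    fun _ => rfl
  classical
  unfold ruleHit hit
  refine if_congr ?_ rfl rfl
  simp only [ruleContent, requestEpoch_eq_pathEpoch T k ω, h]
  rfl

end Transfer

/-! ### Independence, and the compensator of the next request of one object -/

section Independence

variable {Ω : Type*} [MeasurableSpace Ω] {μ : Measure Ω}

theorem indepFun_prodMk_of_indepFun_prodMk {α β γ : Type*} [MeasurableSpace α] [MeasurableSpace β]
    [MeasurableSpace γ] [IsProbabilityMeasure μ] {U : Ω → α} {A : Ω → β} {C : Ω → γ}
    (hU : Measurable U) (hA : Measurable A) (hC : Measurable C)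
    (h1 : IndepFun U (fun ω => (A ω, C ω)) μ) (h2 : IndepFun A C μ) :
    IndepFun (fun ω => (U ω, C ω)) A μ := by
  have := Measure.isProbabilityMeasure_map (μ := μ) hU.aemeasurable
  have := Measure.isProbabilityMeasure_map (μ := μ) hA.aemeasurable
  have := Measure.isProbabilityMeasure_map (μ := μ) hC.aemeasurable
  have h3 : IndepFun U C μ := h1.comp measurable_id measurable_snd
  rw [indepFun_iff_map_prod_eq_prod_map_map (by fun_prop) (by fun_prop)] at h1 h2 h3 ⊢
  rw [h3]
  have e : (fun ω => ((U ω, C ω), A ω)) = (fun q : α × β × γ => ((q.1, q.2.2), q.2.1)) ∘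
      fun ω => (U ω, A ω, C ω) := rfl
  rw [e, ← Measure.map_map (by fun_prop) (by fun_prop), h1, h2]
  have m1 := (MeasurePreserving.id (μ.map U)).prod
    (Measure.measurePreserving_swap (μ := μ.map A) (ν := μ.map C))
  have m2 := (measurePreserving_prodAssoc (μ.map U) (μ.map C) (μ.map A)).symm
  exact (m2.comp m1).map_eq

variable {n : ℕ} {T : Fin n → ℤ → Ω → ℝ}

theorem measurable_update_path (hT : ∀ i k, Measurable (T i k)) (i : Fin n) :
    Measurable fun ω => Function.update (fun j k => T j k ω : EpochPath n) i 0 := by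
  refine measurable_pi_iff.2 fun j => measurable_pi_iff.2 fun k => ?_
  by_cases h : j = i
  · subst h; simp
  · simpa [Function.update_of_ne h] using hT j k

/-- The tie-breaking element together with the requests for the other objects is independent of the
requests for object `i`. -/
theorem indepFun_tie_others {E : Type*} [MeasurableSpace E] [IsProbabilityMeasure μ] {U : Ω → E}
    (hT : ∀ i k, Measurable (T i k))
    (h_indep : iIndepFun (fun (i : Fin n) (ω : Ω) (k : ℤ) => T i k ω) μ)
    (hU : Measurable U) (hUT : IndepFun U (fun ω i k => T i k ω) μ) (i : Fin n) :
    IndepFun (fun ω => (U ω, Function.update (fun j k => T j k ω : EpochPath n) i 0))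
      (fun ω k => T i k ω) μ := by
  have hm : ∀ j, Measurable fun ω k => T j k ω := fun j => measurable_pi_iff.2 (hT j)
  have hup : Measurable fun x : EpochPath n => Function.update x i 0 := by
    refine measurable_pi_iff.2 fun j => ?_
    by_cases h : j = i
    · subst h; simp
    · simpa [Function.update_of_ne h] using measurable_pi_apply j
  refine indepFun_prodMk_of_indepFun_prodMk hU (hm i) (measurable_update_path hT i) ?_ ?_
  · exact hUT.comp (φ := id) (ψ := fun x : EpochPath n => (x i, Function.update x i 0))
      measurable_id ((measurable_pi_apply i).prodMk hup)
  · have h := h_indep.indepFun_finset {i} (Finset.univ.erase i)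
      (by simp) hm
    have hψ : Measurable fun z : ({j // j ∈ Finset.univ.erase i} → ℤ → ℝ) =>
        (fun j => if hj : j ∈ Finset.univ.erase i then z ⟨j, hj⟩ else 0 : EpochPath n) := by
      refine measurable_pi_iff.2 fun j => ?_
      by_cases hj : j ∈ Finset.univ.erase i
      · simpa [hj] using measurable_pi_apply _
      · simp [hj]
    have hφ : Measurable fun z : ({j // j ∈ ({i} : Finset (Fin n))} → ℤ → ℝ) =>
        z ⟨i, Finset.mem_singleton_self i⟩ := measurable_pi_apply _
    have h' := h.comp hφ hψ
    have e : (fun ω => Function.update (fun j k => T j k ω : EpochPath n) i 0) =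
        (fun (z : {j // j ∈ Finset.univ.erase i} → ℤ → ℝ) (j : Fin n) =>
          if hj : j ∈ Finset.univ.erase i then z ⟨j, hj⟩ else 0) ∘
          fun ω j k => T j k ω := by
      funext ω j
      by_cases hj : j = i
      · subst hj; simp
      · simp [hj]
    rw [e]
    exact h'

end Independence

section NextRequest

variable {n : ℕ} {E : Type*} [MeasurableSpace E]

/-- Given the recorded past `p` of all the objects up to the requests `l`, which include the first
`k` requests of all, and given the epochs `x j (l j + 1)` of the next requests for the objects `j`
other than `i`: at time `t`, after the `k`-th request and before (in the sense of `R`) these next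
requests, object `i` is cached by the rule `f`. -/
def CachedWhenNext (R : ℝ → ℝ → Prop) (k : ℕ) (l : Fin n → ℕ)
    (f : E → ℝ → History n → Finset (Fin n)) (i : Fin n) (e : E) (p : History n)
    (x : EpochPath n) (t : ℝ) : Prop :=
  requestEpoch pathEpoch k (extendPast l p) < t ∧ (∀ j, j ≠ i → R t (x j (l j + 1))) ∧ i ∈ f e t p

theorem measurableSet_cachedWhenNext {R : ℝ → ℝ → Prop}
    (hR : MeasurableSet {q : ℝ × ℝ | R q.1 q.2}) (k : ℕ) (l : Fin n → ℕ)
    {f : E → ℝ → History n → Finset (Fin n)}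
    (hf : ∀ S : Finset (Fin n), MeasurableSet {p : E × ℝ × History n | f p.1 p.2.1 p.2.2 = S})
    (i : Fin n) : MeasurableSet {q : (E × History n × EpochPath n) × ℝ |
      CachedWhenNext R k l f i q.1.1 q.1.2.1 q.1.2.2 q.2} := by
  have h1 : Measurable fun q : (E × History n × EpochPath n) × ℝ =>
      requestEpoch pathEpoch k (extendPast l q.1.2.1) :=
    (measurable_requestEpoch k).comp ((measurable_extendPast l).comp (by fun_prop))
  have h2 : ∀ j, Measurable fun q : (E × History n × EpochPath n) × ℝ =>
      (q.2, q.1.2.2 j (l j + 1)) := fun j => by fun_prop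
  have h3 : Measurable fun q : (E × History n × EpochPath n) × ℝ => (q.1.1, q.2, q.1.2.1) := by
    fun_prop
  have e : {q : (E × History n × EpochPath n) × ℝ |
      CachedWhenNext R k l f i q.1.1 q.1.2.1 q.1.2.2 q.2} =
      {q | requestEpoch pathEpoch k (extendPast l q.1.2.1) < q.2} ∩
        ((⋂ j : {j // j ≠ i}, (fun q : (E × History n × EpochPath n) × ℝ =>
          (q.2, q.1.2.2 j (l j + 1))) ⁻¹' {q : ℝ × ℝ | R q.1 q.2}) ∩
        (fun q : (E × History n × EpochPath n) × ℝ => (q.1.1, q.2, q.1.2.1)) ⁻¹'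
          {p : E × ℝ × History n | i ∈ f p.1 p.2.1 p.2.2}) := by
    ext q; simp [CachedWhenNext]
  rw [e]
  exact (measurableSet_lt h1 measurable_snd).inter ((MeasurableSet.iInter fun j : {j // j ≠ i} =>
    h2 j hR).inter (h3 (measurableSet_mem_rule hf i)))

variable {Ω : Type*} [MeasurableSpace Ω] {μ : Measure Ω} [IsProbabilityMeasure μ]
  {T : Fin n → ℤ → Ω → ℝ}

/-- The jointly measurable version of the hazard rate of object `i` after its request `l i`. -/
noncomputable def hazardAfter (w : HistoryWindow) (μ : Measure Ω) [IsProbabilityMeasure μ]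
    (T : Fin n → ℤ → Ω → ℝ) (l : Fin n → ℕ) (i : Fin n) (ω : Ω) (t : ℝ) : ENNReal :=
  kernelHazard (condDistrib (recordedWait w T i (l i + 1)) (pastEpochs w T i (l i + 1)) μ)
    (fun p => p 0) (pastEpochs w T i (l i + 1) ω) t

theorem measurable_pastEpochs (hT : ∀ i k, Measurable (T i k)) (w : HistoryWindow) (i : Fin n)
    (k : ℕ) : Measurable (pastEpochs w T i k) :=
  measurable_pi_iff.2 fun _ => w.measurable_record.comp (hT _ _)

theorem measurable_recordedWait (hT : ∀ i k, Measurable (T i k)) (w : HistoryWindow) (i : Fin n)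
    (k : ℕ) : Measurable (recordedWait w T i k) :=
  (w.measurable_record.comp (hT _ _)).sub (w.measurable_record.comp (hT _ _))

theorem measurable_hazardAfter (hT : ∀ i k, Measurable (T i k)) (w : HistoryWindow)
    (l : Fin n → ℕ) (i : Fin n) :
    Measurable fun q : Ω × ℝ => hazardAfter w μ T l i q.1 q.2 := by
  have h := measurable_kernelHazard
    (condDistrib (recordedWait w T i (l i + 1)) (pastEpochs w T i (l i + 1)) μ)
    (last := fun p : ℕ → ℝ => p 0) (measurable_pi_apply 0)
  exact h.comp (f := fun q : Ω × ℝ => (pastEpochs w T i (l i + 1) q.1, q.2))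
    (((measurable_pastEpochs hT w i _).comp measurable_fst).prodMk measurable_snd)

/-- As long as request `l i + 1` for object `i` is the next one, the measurable version of the
hazard rate agrees with `hazardRate` at almost every time. -/
theorem ae_hazardAfter_eq {w : HistoryWindow} (h_reg : ∀ i, IsRegularProcess w μ T i)
    (l : Fin n → ℕ) : ∀ᵐ ω ∂μ, ∀ᵐ t, ∀ i, nextIndex T i t ω = l i + 1 →
      hazardAfter w μ T l i ω t = ENNReal.ofReal (hazardRate w μ T i t ω) := by
  have h : ∀ i, ∀ᵐ ω ∂μ, waitLaw w μ T i (l i + 1) ω ≪ volume :=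
    fun i => h_reg i (l i + 1) (by omega)
  filter_upwards [ae_all_iff.2 h] with ω hω
  refine ae_all_iff.2 fun i => ?_
  filter_upwards [ae_kernelHazard_eq _ (fun p : ℕ → ℝ => p 0) (hω i)] with t ht hidx
  rw [hazardAfter, ht, hazardRate, hidx]
  simp [waitLaw, pastEpochs]

theorem measurable_path (hT : ∀ i k, Measurable (T i k)) :
    Measurable fun ω => (fun j k => T j k ω : EpochPath n) :=
  measurable_pi_iff.2 fun j => measurable_pi_iff.2 fun k => hT j k

/-- The compensator formula for the next request of object `i`, on the event that this request
comes first and that the rule `f` has cached the object. -/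
theorem lintegral_cachedWhenNext {U : Ω → E} (hT : ∀ i k, Measurable (T i k))
    (h_indep : iIndepFun (fun (i : Fin n) (ω : Ω) (k : ℤ) => T i k ω) μ)
    (hadm : ∀ᵐ ω ∂μ, IsAdmissiblePath (fun j k => T j k ω))
    (hU : Measurable U) (hUT : IndepFun U (fun ω i k => T i k ω) μ)
    {w : HistoryWindow} (h_reg : ∀ i, IsRegularProcess w μ T i)
    {R : ℝ → ℝ → Prop} (hR : MeasurableSet {q : ℝ × ℝ | R q.1 q.2}) (k : ℕ) (l : Fin n → ℕ)
    {f : E → ℝ → History n → Finset (Fin n)}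
    (hf : ∀ S : Finset (Fin n), MeasurableSet {p : E × ℝ × History n | f p.1 p.2.1 p.2.2 = S})
    {g : E × History n → ENNReal} (hg : Measurable g) (i : Fin n) :
    ∫⁻ ω, {ω | CachedWhenNext R k l f i (U ω) (recordedPast w l fun j k => T j k ω)
        (fun j k => T j k ω) (T i (l i + 1) ω)}.indicator
          (fun ω => g (U ω, recordedPast w l fun j k => T j k ω)) ω ∂μ =
      ∫⁻ ω, ∫⁻ t, {q : Ω × ℝ | q.2 < T i (l i + 1) q.1 ∧
          CachedWhenNext R k l f i (U q.1) (recordedPast w l fun j k => T j k q.1)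
            (fun j k => T j k q.1) q.2}.indicator
          (fun q => g (U q.1, recordedPast w l fun j k => T j k q.1) *
            hazardAfter w μ T l i q.1 q.2) (ω, t) ∂volume ∂μ := by
  -- the requests for object `i` are erased from `Y`, which makes `Y` independent of them
  set Y : Ω → E × EpochPath n := fun ω =>
    (U ω, Function.update (fun j k => T j k ω : EpochPath n) i 0) with hYdef
  have hY : Measurable Y := hU.prodMk (measurable_update_path hT i)
  have hP := measurable_pastEpochs hT w i (l i + 1)
  have hW := measurable_recordedWait hT w i (l i + 1)
  have hind : IndepFun Y
      (fun ω => (pastEpochs w T i (l i + 1) ω, recordedWait w T i (l i + 1) ω)) μ := by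
    refine (indepFun_tie_others hT h_indep hU hUT i).comp (φ := id)
      (ψ := fun z : ℤ → ℝ => ((fun m : ℕ => w.record (z (((l i + 1 : ℕ) : ℤ) - 1 - m))),
        w.record (z ((l i + 1 : ℕ) : ℤ)) - w.record (z (((l i + 1 : ℕ) : ℤ) - 1))))
      measurable_id ?_
    have hz : ∀ j : ℤ, Measurable fun z : ℤ → ℝ => w.record (z j) := fun j =>
      w.measurable_record.comp (measurable_pi_apply j)
    exact (measurable_pi_iff.2 fun m => hz _).prodMk ((hz _).sub (hz _))
  -- the past of all the objects, put together from the past of object `i` and that of the others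
  set glue : (E × EpochPath n) × (ℕ → ℝ) → E × History n × EpochPath n := fun q =>
    (q.1.1, Function.update (recordedPast w l q.1.2) i q.2, q.1.2) with hglue
  have hgluem : Measurable glue := by
    refine (measurable_fst.comp measurable_fst).prodMk (Measurable.prodMk ?_
      (measurable_snd.comp measurable_fst))
    refine measurable_pi_iff.2 fun j => ?_
    by_cases h : j = i
    · subst h; simpa using measurable_snd
    · simpa [Function.update_of_ne h, Function.comp_def] using (measurable_pi_apply j).comp
        ((measurable_recordedPast w l).comp (measurable_snd.comp measurable_fst))
  set φ : (E × EpochPath n) × (ℕ → ℝ) → ℝ → ENNReal := fun q t =>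
    {r : (E × History n × EpochPath n) × ℝ |
      CachedWhenNext R k l f i r.1.1 r.1.2.1 r.1.2.2 r.2}.indicator
        (fun r => g (r.1.1, r.1.2.1)) (glue q, t) with hφdef
  have hφ : Measurable fun q : ((E × EpochPath n) × (ℕ → ℝ)) × ℝ => φ q.1 q.2 := by
    have h1 : Measurable fun r : (E × History n × EpochPath n) × ℝ => g (r.1.1, r.1.2.1) :=
      hg.comp (by fun_prop)
    exact (h1.indicator (measurableSet_cachedWhenNext hR k l hf i)).comp
      (f := fun q : ((E × EpochPath n) × (ℕ → ℝ)) × ℝ => (glue q.1, q.2))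
      ((hgluem.comp measurable_fst).prodMk measurable_snd)
  have key := lintegral_eq_lintegral_compensator hY hP hW hind (h_reg i (l i + 1) (by omega))
    (last := fun p : ℕ → ℝ => p 0) (measurable_pi_apply 0) hφ
  have hupd : ∀ ω, Function.update (recordedPast w l (Y ω).2) i (pastEpochs w T i (l i + 1) ω) =
      recordedPast w l fun j k => T j k ω := fun ω => by
    funext j
    by_cases h : j = i
    · subst h; simp only [Function.update_self]; rfl
    · rw [Function.update_of_ne h]
      funext m
      simp [hYdef, recordedPast, pastEpochs, pathEpoch, Function.update_of_ne h]
  have hset : ∀ ω t, CachedWhenNext R k l f i (U ω) (recordedPast w l fun j k => T j k ω)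
      (Y ω).2 t ↔ CachedWhenNext R k l f i (U ω) (recordedPast w l fun j k => T j k ω)
      (fun j k => T j k ω) t := fun ω t => by
    refine and_congr_right fun _ => and_congr_left fun _ => forall_congr' fun j =>
      forall_congr' fun hj => ?_
    simp [hYdef, Function.update_of_ne hj]
  have hφω : ∀ ω t, φ (Y ω, pastEpochs w T i (l i + 1) ω) t =
      {t | CachedWhenNext R k l f i (U ω) (recordedPast w l fun j k => T j k ω)
        (fun j k => T j k ω) t}.indicator
        (fun _ => g (U ω, recordedPast w l fun j k => T j k ω)) t := fun ω t => by
    have hgl : glue (Y ω, pastEpochs w T i (l i + 1) ω) =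
        (U ω, recordedPast w l (fun j k => T j k ω), (Y ω).2) := by
      simp only [hglue, hupd]
      rfl
    simp only [hφdef]
    rw [hgl]
    have e1 : (((U ω, recordedPast w l (fun j k => T j k ω), (Y ω).2), t) :
        (E × History n × EpochPath n) × ℝ) ∈ {r : (E × History n × EpochPath n) × ℝ |
          CachedWhenNext R k l f i r.1.1 r.1.2.1 r.1.2.2 r.2} ↔
        t ∈ {t | CachedWhenNext R k l f i (U ω) (recordedPast w l fun j k => T j k ω)
          (fun j k => T j k ω) t} := hset ω t
    by_cases h : t ∈ {t | CachedWhenNext R k l f i (U ω) (recordedPast w l fun j k => T j k ω)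
        (fun j k => T j k ω) t}
    · rw [Set.indicator_of_mem (e1.2 h), Set.indicator_of_mem h]
    · rw [Set.indicator_of_notMem (fun h' => h (e1.1 h')), Set.indicator_of_notMem h]
  have hlast : ∀ᵐ ω ∂μ, pastEpochs w T i (l i + 1) ω 0 + recordedWait w T i (l i + 1) ω =
      T i (l i + 1) ω := by
    filter_upwards [hadm] with ω hω
    have h := hω.pos i (show 1 ≤ l i + 1 by omega)
    simp only [pastEpochs, recordedWait, Nat.cast_zero, sub_zero]
    rw [add_sub_cancel, w.record_of_nonneg h.le]
    simp
  simp only [hφω] at key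
  refine Eq.trans (lintegral_congr_ae ?_) (key.trans (lintegral_congr_ae ?_))
  · filter_upwards [hlast] with ω hω
    rw [hω]; rfl
  · filter_upwards [hlast] with ω hω
    rw [hω]
    refine lintegral_congr fun t => ?_
    simp only [Set.indicator, Set.mem_ofPred_eq, Set.mem_Iio, hazardAfter]
    split_ifs <;> simp_all

end NextRequest

/-! ### One step: the hazard-rate rule maximizes the probability of the next hit -/

/-- Both sums contain the terms of `A ∩ C`. The remaining sets `A \ C` and `C \ A` have the same
cardinality, and no value on the first exceeds a value on the second. -/
theorem sum_le_sum_of_largest {ι : Type*} [DecidableEq ι] {A C : Finset ι} (hcard : A.card = C.card)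
    {v : ι → ENNReal} (h : ∀ i ∈ C, ∀ j ∉ C, v j ≤ v i) : ∑ i ∈ A, v i ≤ ∑ i ∈ C, v i := by
  rw [← Finset.sum_inter_add_sum_sdiff A C, ← Finset.sum_inter_add_sum_sdiff C A,
    Finset.inter_comm C A]
  refine add_le_add le_rfl ?_
  have hc : (A \ C).card = (C \ A).card := Finset.card_sdiff_comm hcard
  calc ∑ i ∈ A \ C, v i ≤ (A \ C).card • (A \ C).sup v :=
        Finset.sum_le_card_nsmul _ _ _ fun i hi => Finset.le_sup hi
    _ = (C \ A).card • (A \ C).sup v := by rw [hc]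
    _ ≤ ∑ i ∈ C \ A, v i := Finset.card_nsmul_le_sum _ _ _ fun i hi =>
        Finset.sup_le fun j hj =>
          h i (Finset.mem_sdiff.1 hi).1 j (Finset.mem_sdiff.1 hj).2

section OneStep

variable {n : ℕ} {E : Type*}

/-- The weight `Z`, evaluated on the recorded past up to the requests `l`, on the event that these
are the first `k` requests of all. -/
noncomputable def pastWeight (k : ℕ) (l : Fin n → ℕ) (Z : E × EpochPath n → ENNReal) :
    E × History n → ENNReal :=
  {q | HasCounts l (requestEpoch pathEpoch k (extendPast l q.2)) (extendPast l q.2)}.indicator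
    fun q => Z (q.1, extendPast l q.2)

/-- The weight `Z` depends on the tie-breaking element and the requests up to the `k`-th only. -/
def IsPastWeight (w : HistoryWindow) (k : ℕ) (Z : E × EpochPath n → ENNReal) : Prop :=
  ∀ e l x y, IsAdmissiblePath x → AgreeUpTo w l (requestEpoch pathEpoch k x) x y →
    Z (e, y) = Z (e, x)

theorem measurable_pastWeight [MeasurableSpace E] (k : ℕ) (l : Fin n → ℕ)
    {Z : E × EpochPath n → ENNReal} (hZ : Measurable Z) : Measurable (pastWeight k l Z) := by
  have h : Measurable fun q : E × History n => (q.1, extendPast l q.2) :=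
    measurable_fst.prodMk ((measurable_extendPast l).comp measurable_snd)
  exact (hZ.comp h).indicator (((measurable_extendPast l).comp measurable_snd)
    (measurableSet_hasCounts l k))

theorem hasCounts_of_pastWeight_ne_zero {k : ℕ} {l : Fin n → ℕ} {Z : E × EpochPath n → ENNReal}
    {e : E} {p : History n} (h : pastWeight k l Z (e, p) ≠ 0) :
    HasCounts l (requestEpoch pathEpoch k (extendPast l p)) (extendPast l p) :=
  Set.mem_of_indicator_ne_zero h

theorem ruleHit_nonneg (w : HistoryWindow) (f : ℝ → History n → Finset (Fin n)) (k : ℕ)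
    (x : EpochPath n) : 0 ≤ ruleHit w f k x := by
  unfold ruleHit hit
  split_ifs <;> norm_num

theorem ruleHit_le_one (w : HistoryWindow) (f : ℝ → History n → Finset (Fin n)) (k : ℕ)
    (x : EpochPath n) : ruleHit w f k x ≤ 1 := by
  unfold ruleHit hit
  split_ifs <;> norm_num

variable [Nonempty (Fin n)] {w : HistoryWindow} {k : ℕ} {l : Fin n → ℕ} {x : EpochPath n}
  {Z : E × EpochPath n → ENNReal} {f : E → ℝ → History n → Finset (Fin n)} {e : E}

theorem HasCounts.pastWeight_eq (hx : IsAdmissiblePath x)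
    (hl : HasCounts l (requestEpoch pathEpoch k x) x) (hZ : IsPastWeight w k Z) :
    pastWeight k l Z (e, recordedPast w l x) = Z (e, x) := by
  have h := ((hasCounts_requestEpoch_iff (w := w) hx).1 hl).1
  rw [pastWeight, Set.indicator_of_mem (show _ ∈ {q : E × History n | HasCounts l
    (requestEpoch pathEpoch k (extendPast l q.2)) (extendPast l q.2)} from h)]
  exact hZ e l x _ hx (hl.agreeUpTo_extendPast hx)

theorem HasCounts.requestEpoch_extendPast (hx : IsAdmissiblePath x)
    (hl : HasCounts l (requestEpoch pathEpoch k x) x) :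
    requestEpoch pathEpoch k (extendPast l (recordedPast w l x)) = requestEpoch pathEpoch k x :=
  (hl.agreeUpTo_extendPast hx).requestEpoch_eq hx k le_rfl

/-- Lower bound for a hit: there is one when the strictly first pending request is for a cached
object. -/
theorem sum_cachedWhenNext_le_hit (hx : IsAdmissiblePath x) (hZ : IsPastWeight w k Z) :
    ∑ i, {t | CachedWhenNext (· < ·) k l f i e (recordedPast w l x) x t}.indicator
        (fun _ => pastWeight k l Z (e, recordedPast w l x)) (x i (l i + 1)) ≤
      {x | HasCounts l (requestEpoch pathEpoch k x) x}.indicator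
        (fun x => Z (e, x) * ENNReal.ofReal (ruleHit w (f e) (k + 1) x)) x := by
  by_cases h0 : ∃ i, {t | CachedWhenNext (· < ·) k l f i e (recordedPast w l x) x t}.indicator
        (fun _ => pastWeight k l Z (e, recordedPast w l x)) (x i (l i + 1)) ≠ 0
  · obtain ⟨i, hi⟩ := h0
    obtain ⟨hi1, hi2, hi3⟩ := Set.mem_of_indicator_ne_zero hi
    have hw : pastWeight k l Z (e, recordedPast w l x) ≠ 0 := fun h => hi (by simp [h])
    have hl : HasCounts l (requestEpoch pathEpoch k x) x := by
      refine (hasCounts_requestEpoch_iff (w := w) hx).2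
        ⟨hasCounts_of_pastWeight_ne_zero hw, fun j => ?_⟩
      by_cases hj : j = i
      · rw [hj]; exact hi1
      · exact hi1.trans (hi2 j hj)
    rw [Finset.sum_eq_single i, Set.indicator_of_mem (Set.mem_of_indicator_ne_zero hi),
      Set.indicator_of_mem (show x ∈ {x | HasCounts l (requestEpoch pathEpoch k x) x} from hl),
      hl.pastWeight_eq hx hZ]
    · obtain ⟨i', hmin, he⟩ := hl.requestEpoch_succ hx
      have hii : i' = i := by
        by_contra hc
        exact absurd (hmin i) (not_le.2 (hi2 i' hc))
      subst hii
      have hhit : ruleHit w (f e) (k + 1) x = 1 := by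
        unfold ruleHit hit
        refine if_pos ⟨i', ?_, l i' + 1, by omega, ?_⟩
        · simp only [ruleContent]
          rw [he, hl.historyBefore_eq hx w (hl i').2 hmin]
          exact hi3
        · rw [he]; simp [pathEpoch]
      simp [hhit]
    · intro j _ hj
      refine Set.indicator_of_notMem (fun h => ?_) _
      exact lt_asymm (h.2.1 i hj.symm) (hi2 j hj)
    · simp
  · push Not at h0
    rw [Finset.sum_eq_zero fun i _ => h0 i]
    exact zero_le

/-- Upper bound for a hit: the request is for a cached object, and it comes first among the
pending requests. -/
theorem hit_le_sum_cachedWhenNext (hx : IsAdmissiblePath x) (hZ : IsPastWeight w k Z) :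
    {x | HasCounts l (requestEpoch pathEpoch k x) x}.indicator
        (fun x => Z (e, x) * ENNReal.ofReal (ruleHit w (f e) (k + 1) x)) x ≤
      ∑ i, {t | CachedWhenNext (· ≤ ·) k l f i e (recordedPast w l x) x t}.indicator
        (fun _ => pastWeight k l Z (e, recordedPast w l x)) (x i (l i + 1)) := by
  by_cases hl : HasCounts l (requestEpoch pathEpoch k x) x
  swap
  · rw [Set.indicator_of_notMem (show x ∉ {x | HasCounts l (requestEpoch pathEpoch k x) x} from hl)]
    exact zero_le
  rw [Set.indicator_of_mem (show x ∈ {x | HasCounts l (requestEpoch pathEpoch k x) x} from hl)]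
  by_cases hh : ∃ i ∈ ruleContent (fun _ => ()) (fun _ => f e) w pathEpoch (k + 1) x,
      ∃ j : ℕ, 1 ≤ j ∧ pathEpoch i j x = requestEpoch pathEpoch (k + 1) x
  swap
  · have : ruleHit w (f e) (k + 1) x = 0 := if_neg hh
    simp [this]
  obtain ⟨i, hi, j, hj, hij⟩ := hh
  obtain ⟨i', hmin, he⟩ := hl.requestEpoch_succ hx
  have hij' : x i j = x i' (l i' + 1) := by rw [← he]; exact hij
  have hlj : l i + 1 ≤ j := hl.lt_index hx (by rw [hij']; exact (hl i').2)
  have hτ : x i (l i + 1) = x i' (l i' + 1) :=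
    le_antisymm (hij' ▸ hx.le_of_index_le i hlj) (hmin i)
  have hmem : CachedWhenNext (· ≤ ·) k l f i e (recordedPast w l x) x (x i (l i + 1)) := by
    refine ⟨?_, fun m _ => hτ ▸ hmin m, ?_⟩
    · rw [hl.requestEpoch_extendPast hx]; exact (hl i).2
    · simp only [ruleContent] at hi
      rw [he, hl.historyBefore_eq hx w (hl i').2 hmin] at hi
      rw [hτ]; exact hi
  calc Z (e, x) * ENNReal.ofReal (ruleHit w (f e) (k + 1) x) ≤ Z (e, x) * 1 :=
        mul_le_mul_right (ENNReal.ofReal_le_one.2 (ruleHit_le_one _ _ _ _)) _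
    _ = {t | CachedWhenNext (· ≤ ·) k l f i e (recordedPast w l x) x t}.indicator
        (fun _ => pastWeight k l Z (e, recordedPast w l x)) (x i (l i + 1)) := by
        rw [Set.indicator_of_mem (show x i (l i + 1) ∈ {t | CachedWhenNext (· ≤ ·) k l f i e
          (recordedPast w l x) x t} from hmem),
          hl.pastWeight_eq hx hZ, mul_one]
    _ ≤ _ := Finset.single_le_sum (f := fun i =>
        {t | CachedWhenNext (· ≤ ·) k l f i e (recordedPast w l x) x t}.indicator
          (fun _ => pastWeight k l Z (e, recordedPast w l x)) (x i (l i + 1)))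
        (fun _ _ => zero_le) (Finset.mem_univ i)

end OneStep

/-- The counts of the requests for each object among the first `k` split the probability space into
countably many events. -/
theorem lintegral_eq_tsum_hasCounts {n : ℕ} {E Ω : Type*} [MeasurableSpace E] [MeasurableSpace Ω]
    {μ : Measure Ω} {T : Fin n → ℤ → Ω → ℝ} {U : Ω → E} [Nonempty (Fin n)]
    (hT : ∀ i k, Measurable (T i k))
    (hadm : ∀ᵐ ω ∂μ, IsAdmissiblePath (fun j k => T j k ω)) (hU : Measurable U) (k : ℕ)
    {F : E × EpochPath n → ENNReal} (hF : Measurable F) :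
    ∫⁻ ω, F (U ω, fun j k => T j k ω) ∂μ =
      ∑' l : Fin n → ℕ, ∫⁻ ω, {x | HasCounts l (requestEpoch pathEpoch k x) x}.indicator
        (fun x => F (U ω, x)) (fun j k => T j k ω) ∂μ := by
  have hX := measurable_path hT
  rw [← lintegral_tsum]
  · refine lintegral_congr_ae ?_
    filter_upwards [hadm] with ω hx
    obtain ⟨l, hl⟩ := exists_hasCounts_requestEpoch hx k
    rw [tsum_eq_single l, Set.indicator_of_mem (show _ ∈ _ from hl)]
    intro l' hl'
    exact Set.indicator_of_notMem (fun h => hl' (HasCounts.unique hx h hl)) _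
  · intro l
    exact ((hF.comp (hU.prodMk hX)).indicator (hX (measurableSet_hasCounts l k))).aemeasurable

/-- The intensity at time `t` of a request for object `i` that comes first after the `k`-th request
and that is for an object cached by `f`, weighted with `g`. -/
noncomputable def cachedIntensity {n : ℕ} {E Ω : Type*} [MeasurableSpace Ω]
    (μ : Measure Ω) [IsProbabilityMeasure μ]
    (T : Fin n → ℤ → Ω → ℝ) (U : Ω → E) (w : HistoryWindow) (R : ℝ → ℝ → Prop) (k : ℕ)
    (l : Fin n → ℕ) (f : E → ℝ → History n → Finset (Fin n)) (g : E × History n → ENNReal)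
    (i : Fin n) : Ω × ℝ → ENNReal :=
  {q : Ω × ℝ | q.2 < T i (l i + 1) q.1 ∧
    CachedWhenNext R k l f i (U q.1) (recordedPast w l fun j k => T j k q.1)
      (fun j k => T j k q.1) q.2}.indicator
    (fun q => g (U q.1, recordedPast w l fun j k => T j k q.1) * hazardAfter w μ T l i q.1 q.2)

/-- Before all the pending requests, the total intensity is the sum of the hazard rates over the
cached objects. -/
theorem sum_cachedIntensity_eq {n : ℕ} {E Ω : Type*} [MeasurableSpace Ω] {μ : Measure Ω}
    [IsProbabilityMeasure μ] {T : Fin n → ℤ → Ω → ℝ} {U : Ω → E} {w : HistoryWindow}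
    {R : ℝ → ℝ → Prop} (hR : ∀ a b, a < b → R a b) {k : ℕ}
    {l : Fin n → ℕ} {f : E → ℝ → History n → Finset (Fin n)} {g : E × History n → ENNReal}
    {ω : Ω} {t : ℝ}
    (h1 : requestEpoch pathEpoch k (extendPast l (recordedPast w l fun j k => T j k ω)) < t)
    (h2 : ∀ j, t < T j (l j + 1) ω) :
    ∑ i, cachedIntensity μ T U w R k l f g i (ω, t) =
      g (U ω, recordedPast w l fun j k => T j k ω) *
        ∑ i ∈ f (U ω) t (recordedPast w l fun j k => T j k ω), hazardAfter w μ T l i ω t := by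
  rw [Finset.mul_sum, ← Finset.sum_subset (Finset.subset_univ
    (f (U ω) t (recordedPast w l fun j k => T j k ω)))]
  · refine Finset.sum_congr rfl fun i hi => ?_
    unfold cachedIntensity
    refine Set.indicator_of_mem ?_ _
    exact ⟨h2 i, h1, fun j _ => hR _ _ (h2 j), hi⟩
  · intro i _ hi
    exact Set.indicator_of_notMem (fun h => hi h.2.2.2) _

section Comparison

variable {n : ℕ} {E : Type*} [MeasurableSpace E] {Ω : Type*} [MeasurableSpace Ω] {μ : Measure Ω}
  [IsProbabilityMeasure μ] {T : Fin n → ℤ → Ω → ℝ} {U : Ω → E} {w : HistoryWindow}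

theorem measurable_cachedIntensity (hT : ∀ i k, Measurable (T i k)) (hU : Measurable U)
    {R : ℝ → ℝ → Prop} (hR : MeasurableSet {q : ℝ × ℝ | R q.1 q.2}) (k : ℕ) (l : Fin n → ℕ)
    {f : E → ℝ → History n → Finset (Fin n)}
    (hf : ∀ S : Finset (Fin n), MeasurableSet {p : E × ℝ × History n | f p.1 p.2.1 p.2.2 = S})
    {g : E × History n → ENNReal} (hg : Measurable g) (i : Fin n) :
    Measurable (cachedIntensity μ T U w R k l f g i) := by
  have hX := measurable_path hT
  have hP : Measurable fun ω => recordedPast w l fun j k => T j k ω :=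
    (measurable_recordedPast w l).comp hX
  have h1 : Measurable fun q : Ω × ℝ => g (U q.1, recordedPast w l fun j k => T j k q.1) :=
    hg.comp ((hU.prodMk hP).comp measurable_fst)
  refine (h1.mul (measurable_hazardAfter hT w l i)).indicator (MeasurableSet.inter
    (measurableSet_lt measurable_snd ((hT i _).comp measurable_fst)) ?_)
  have h2 : Measurable fun q : Ω × ℝ =>
      (((U q.1, (recordedPast w l fun j k => T j k q.1), (fun j k => T j k q.1)) :
        E × History n × EpochPath n), q.2) :=
    ((hU.prodMk (hP.prodMk hX)).comp measurable_fst).prodMk measurable_snd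
  exact h2 (measurableSet_cachedWhenNext hR k l hf i)

theorem sum_lintegral_cachedIntensity (hT : ∀ i k, Measurable (T i k)) (hU : Measurable U)
    {R : ℝ → ℝ → Prop} (hR : MeasurableSet {q : ℝ × ℝ | R q.1 q.2}) (k : ℕ) (l : Fin n → ℕ)
    {f : E → ℝ → History n → Finset (Fin n)}
    (hf : ∀ S : Finset (Fin n), MeasurableSet {p : E × ℝ × History n | f p.1 p.2.1 p.2.2 = S})
    {g : E × History n → ENNReal} (hg : Measurable g) :
    ∑ i, ∫⁻ ω, ∫⁻ t, cachedIntensity μ T U w R k l f g i (ω, t) ∂volume ∂μ =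
      ∫⁻ ω, ∫⁻ t, ∑ i, cachedIntensity μ T U w R k l f g i (ω, t) ∂volume ∂μ := by
  have hm := fun i => measurable_cachedIntensity (μ := μ) (w := w) hT hU hR k l hf hg i
  rw [← lintegral_finsetSum _ fun i _ => (hm i).lintegral_prod_right']
  refine lintegral_congr fun ω => ?_
  exact (lintegral_finsetSum (μ := volume) Finset.univ
    (f := fun i t => cachedIntensity μ T U w R k l f g i (ω, t))
    fun i _ => (hm i).comp measurable_prodMk_left).symm

/-- At almost every time, the total intensity of the requests for the
cached objects is largest when the objects with the largest hazard rates are cached. -/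
theorem ae_sum_cachedIntensity_le [Nonempty (Fin n)]
    (hadm : ∀ᵐ ω ∂μ, IsAdmissiblePath (fun j k => T j k ω))
    (h_reg : ∀ i, IsRegularProcess w μ T i) {B : ℕ} {ρ : E → ℝ → History n → Finset (Fin n)}
    (h_rule : IsHazardRateRule w μ T B U ρ) {f : E → ℝ → History n → Finset (Fin n)}
    (hcard : ∀ e t h, (f e t h).card = B) (k : ℕ) (l : Fin n → ℕ)
    (Z : E × EpochPath n → ENNReal) :
    ∀ᵐ ω ∂μ, ∀ᵐ t, ∑ i, cachedIntensity μ T U w (· ≤ ·) k l f (pastWeight k l Z) i (ω, t) ≤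
      ∑ i, cachedIntensity μ T U w (· < ·) k l ρ (pastWeight k l Z) i (ω, t) := by
  filter_upwards [hadm, h_rule.largest, ae_hazardAfter_eq h_reg l] with ω hx hlarge hhaz
  -- away from the pending request epochs, the weak and the strict precedence agree
  have hne : ∀ᵐ t : ℝ, ∀ j, t ≠ T j (l j + 1) ω := ae_all_iff.2 fun j => Measure.ae_ne volume _
  filter_upwards [hhaz, hne] with t ht htne
  by_cases h0 : ∃ i, cachedIntensity μ T U w (· ≤ ·) k l f (pastWeight k l Z) i (ω, t) ≠ 0
  swap
  · push Not at h0
    rw [Finset.sum_eq_zero fun i _ => h0 i]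
    exact zero_le
  obtain ⟨i, hi⟩ := h0
  obtain ⟨hi1, hi2, hi3, -⟩ := Set.mem_of_indicator_ne_zero hi
  simp only at hi1 hi2 hi3
  have hw : pastWeight k l Z (U ω, recordedPast w l fun j k => T j k ω) ≠ 0 := fun h => hi (by
    rw [cachedIntensity, Set.indicator_of_mem (Set.mem_of_indicator_ne_zero hi)]
    simp [h])
  have hall : ∀ j, t < T j (l j + 1) ω := fun j => by
    by_cases hj : j = i
    · rw [hj]; exact hi1
    · exact lt_of_le_of_ne (hi3 j hj) (htne j)
  have hl : HasCounts l (requestEpoch pathEpoch k fun j k => T j k ω) (fun j k => T j k ω) :=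
    (hasCounts_requestEpoch_iff (w := w) hx).2
      ⟨hasCounts_of_pastWeight_ne_zero hw, fun j => hi2.trans (hall j)⟩
  have hst := hi2
  rw [hl.requestEpoch_extendPast hx] at hst
  have hhist : historyBefore w T t ω = recordedPast w l fun j k => T j k ω :=
    hl.historyBefore_eq hx w hst fun j => (hall j).le
  have hidx : ∀ j, nextIndex T j t ω = l j + 1 := fun j => hl.nextIndex_eq hx hst (hall j).le
  have hL := hlarge t ((requestEpoch_bounds hx k).1.trans_lt hst)
  rw [hhist] at hL
  rw [sum_cachedIntensity_eq (fun _ _ => le_of_lt) hi2 hall,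
    sum_cachedIntensity_eq (fun _ _ => id) hi2 hall]
  refine mul_le_mul_right (sum_le_sum_of_largest ?_ fun a ha b hb => ?_) _
  · rw [hcard, h_rule.card_rule]
  · rw [ht a (hidx a), ht b (hidx b)]
    exact ENNReal.ofReal_le_ofReal (hL a ha b hb)

/-- The comparison of the probabilities of a hit at the next request, on the event that the counts
of the requests up to the `k`-th are `l`. -/
theorem lintegral_hit_le_of_hasCounts [Nonempty (Fin n)] (hT : ∀ i k, Measurable (T i k))
    (h_indep : iIndepFun (fun (i : Fin n) (ω : Ω) (k : ℤ) => T i k ω) μ)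
    (hadm : ∀ᵐ ω ∂μ, IsAdmissiblePath (fun j k => T j k ω))
    (h_reg : ∀ i, IsRegularProcess w μ T i) {B : ℕ} {ρ : E → ℝ → History n → Finset (Fin n)}
    (h_rule : IsHazardRateRule w μ T B U ρ) {f : E → ℝ → History n → Finset (Fin n)}
    (hf : ∀ S : Finset (Fin n), MeasurableSet {p : E × ℝ × History n | f p.1 p.2.1 p.2.2 = S})
    (hcard : ∀ e t h, (f e t h).card = B) (k : ℕ) (l : Fin n → ℕ)
    {Z : E × EpochPath n → ENNReal} (hZm : Measurable Z) (hZ : IsPastWeight w k Z) :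
    ∫⁻ ω, {x | HasCounts l (requestEpoch pathEpoch k x) x}.indicator
        (fun x => Z (U ω, x) * ENNReal.ofReal (ruleHit w (f (U ω)) (k + 1) x))
        (fun j k => T j k ω) ∂μ ≤
      ∫⁻ ω, {x | HasCounts l (requestEpoch pathEpoch k x) x}.indicator
        (fun x => Z (U ω, x) * ENNReal.ofReal (ruleHit w (ρ (U ω)) (k + 1) x))
        (fun j k => T j k ω) ∂μ := by
  have hU := h_rule.measurable_tie
  have hg := measurable_pastWeight k l hZm
  have hlt : MeasurableSet {q : ℝ × ℝ | q.1 < q.2} := measurableSet_lt measurable_fst measurable_snd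
  have hle : MeasurableSet {q : ℝ × ℝ | q.1 ≤ q.2} := measurableSet_le measurable_fst measurable_snd
  have hm : ∀ {R : ℝ → ℝ → Prop}, MeasurableSet {q : ℝ × ℝ | R q.1 q.2} →
      ∀ {f : E → ℝ → History n → Finset (Fin n)},
      (∀ S, MeasurableSet {p : E × ℝ × History n | f p.1 p.2.1 p.2.2 = S}) → ∀ i : Fin n,
      Measurable fun ω => {ω | CachedWhenNext R k l f i (U ω) (recordedPast w l fun j k => T j k ω)
        (fun j k => T j k ω) (T i (l i + 1) ω)}.indicator
          (fun ω => pastWeight k l Z (U ω, recordedPast w l fun j k => T j k ω)) ω := by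
    intro R hR f hf i
    have hX := measurable_path hT
    have hP : Measurable fun ω => recordedPast w l fun j k => T j k ω :=
      (measurable_recordedPast w l).comp hX
    have h2 : Measurable fun ω => (((U ω, (recordedPast w l fun j k => T j k ω),
        (fun j k => T j k ω)) : E × History n × EpochPath n), T i (l i + 1) ω) :=
      (hU.prodMk (hP.prodMk hX)).prodMk (hT i _)
    exact (hg.comp (hU.prodMk hP)).indicator (h2 (measurableSet_cachedWhenNext hR k l hf i))
  calc _ ≤ ∫⁻ ω, ∑ i, {ω | CachedWhenNext (· ≤ ·) k l f i (U ω)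
          (recordedPast w l fun j k => T j k ω) (fun j k => T j k ω) (T i (l i + 1) ω)}.indicator
          (fun ω => pastWeight k l Z (U ω, recordedPast w l fun j k => T j k ω)) ω ∂μ := by
        refine lintegral_mono_ae ?_
        filter_upwards [hadm] with ω hx
        exact hit_le_sum_cachedWhenNext hx hZ
    _ = ∑ i, ∫⁻ ω, ∫⁻ t, cachedIntensity μ T U w (· ≤ ·) k l f (pastWeight k l Z) i (ω, t)
          ∂volume ∂μ := by
        rw [lintegral_finsetSum _ fun i _ => hm hle hf i]
        exact Finset.sum_congr rfl fun i _ => lintegral_cachedWhenNext hT h_indep hadm hU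
          h_rule.indep_tie h_reg hle k l hf hg i
    _ ≤ ∑ i, ∫⁻ ω, ∫⁻ t, cachedIntensity μ T U w (· < ·) k l ρ (pastWeight k l Z) i (ω, t)
          ∂volume ∂μ := by
        rw [sum_lintegral_cachedIntensity hT hU hle k l hf hg,
          sum_lintegral_cachedIntensity hT hU hlt k l h_rule.measurable_rule hg]
        refine lintegral_mono_ae ?_
        filter_upwards [ae_sum_cachedIntensity_le hadm h_reg h_rule hcard k l Z] with ω hω
        exact lintegral_mono_ae hω
    _ = ∫⁻ ω, ∑ i, {ω | CachedWhenNext (· < ·) k l ρ i (U ω)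
          (recordedPast w l fun j k => T j k ω) (fun j k => T j k ω) (T i (l i + 1) ω)}.indicator
          (fun ω => pastWeight k l Z (U ω, recordedPast w l fun j k => T j k ω)) ω ∂μ := by
        rw [lintegral_finsetSum _ fun i _ => hm hlt h_rule.measurable_rule i]
        exact (Finset.sum_congr rfl fun i _ => lintegral_cachedWhenNext hT h_indep hadm hU
          h_rule.indep_tie h_reg hlt k l h_rule.measurable_rule hg i).symm
    _ ≤ _ := by
        refine lintegral_mono_ae ?_
        filter_upwards [hadm] with ω hx
        exact sum_cachedWhenNext_le_hit hx hZ

/-- The hazard-rate rule has the largest probability of a hit at the next request, under every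
weight that depends on the past. -/
theorem lintegral_hit_le [Nonempty (Fin n)] (hT : ∀ i k, Measurable (T i k))
    (h_indep : iIndepFun (fun (i : Fin n) (ω : Ω) (k : ℤ) => T i k ω) μ)
    (hadm : ∀ᵐ ω ∂μ, IsAdmissiblePath (fun j k => T j k ω))
    (h_reg : ∀ i, IsRegularProcess w μ T i) {B : ℕ} {ρ : E → ℝ → History n → Finset (Fin n)}
    (h_rule : IsHazardRateRule w μ T B U ρ) {f : E → ℝ → History n → Finset (Fin n)}
    (hf : ∀ S : Finset (Fin n), MeasurableSet {p : E × ℝ × History n | f p.1 p.2.1 p.2.2 = S})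
    (hcard : ∀ e t h, (f e t h).card = B) (k : ℕ)
    {Z : E × EpochPath n → ENNReal} (hZm : Measurable Z) (hZ : IsPastWeight w k Z) :
    ∫⁻ ω, Z (U ω, fun j k => T j k ω) *
        ENNReal.ofReal (ruleHit w (f (U ω)) (k + 1) fun j k => T j k ω) ∂μ ≤
      ∫⁻ ω, Z (U ω, fun j k => T j k ω) *
        ENNReal.ofReal (ruleHit w (ρ (U ω)) (k + 1) fun j k => T j k ω) ∂μ := by
  have hm : ∀ {f : E → ℝ → History n → Finset (Fin n)},
      (∀ S, MeasurableSet {p : E × ℝ × History n | f p.1 p.2.1 p.2.2 = S}) →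
      Measurable fun q : E × EpochPath n =>
        Z q * ENNReal.ofReal (ruleHit w (f q.1) (k + 1) q.2) := fun hf =>
    hZm.mul (ENNReal.measurable_ofReal.comp (measurable_ruleHit hf w (k + 1)))
  rw [lintegral_eq_tsum_hasCounts hT hadm h_rule.measurable_tie k (hm hf),
    lintegral_eq_tsum_hasCounts hT hadm h_rule.measurable_tie k (hm h_rule.measurable_rule)]
  exact ENNReal.tsum_le_tsum fun l =>
    lintegral_hit_le_of_hasCounts hT h_indep hadm h_reg h_rule hf hcard k l hZm hZ

end Comparison

/-! ### Long-run averages -/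

theorem hitRatio_sub_eq {n : ℕ} {Ω : Type*} (T : Fin n → ℤ → Ω → ℝ) (C C' : ℕ → Ω → Finset (Fin n))
    (K : ℕ) (ω : Ω) :
    hitRatio T C K ω - hitRatio T C' K ω =
      (∑ j ∈ Finset.range K, (hit T C (j + 1) ω - hit T C' (j + 1) ω)) / (K : ℝ) := by
  have h : ∀ F : ℕ → ℝ, ∑ k ∈ Finset.Icc 1 K, F k = ∑ j ∈ Finset.range K, F (j + 1) := fun F => by
    rw [Finset.range_eq_Ico, Finset.sum_Ico_add' F 0 K 1]
    rfl
  rw [hitRatio, hitRatio, ← sub_div, h, h, Finset.sum_sub_distrib]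

section LongRun

variable {n : ℕ} {E : Type*} [MeasurableSpace E] {Ω : Type*} [MeasurableSpace Ω] {μ : Measure Ω}
  [IsProbabilityMeasure μ] {T : Fin n → ℤ → Ω → ℝ} {U : Ω → E} {w : HistoryWindow}

/-- The tilted mean of the next difference of hits is nonnegative. -/
theorem integral_exp_neg_mul_hit_sub_nonneg [Nonempty (Fin n)] (hT : ∀ i k, Measurable (T i k))
    (h_indep : iIndepFun (fun (i : Fin n) (ω : Ω) (k : ℤ) => T i k ω) μ)
    (hadm : ∀ᵐ ω ∂μ, IsAdmissiblePath (fun j k => T j k ω))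
    (h_reg : ∀ i, IsRegularProcess w μ T i) {B : ℕ} {ρ : E → ℝ → History n → Finset (Fin n)}
    (h_rule : IsHazardRateRule w μ T B U ρ) {f : E → ℝ → History n → Finset (Fin n)}
    (hf : ∀ S : Finset (Fin n), MeasurableSet {p : E × ℝ × History n | f p.1 p.2.1 p.2.2 = S})
    (hcard : ∀ e t h, (f e t h).card = B) {s : ℝ} (hs : 0 ≤ s) (k : ℕ) :
    0 ≤ ∫ ω, Real.exp (-(s * ∑ j ∈ Finset.range k,
        (ruleHit w (ρ (U ω)) (j + 1) (fun j k => T j k ω) -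
          ruleHit w (f (U ω)) (j + 1) fun j k => T j k ω))) *
        (ruleHit w (ρ (U ω)) (k + 1) (fun j k => T j k ω) -
          ruleHit w (f (U ω)) (k + 1) fun j k => T j k ω) ∂μ := by
  have hX := measurable_path hT
  have hU := h_rule.measurable_tie
  have hmf := fun j => measurable_ruleHit hf w j
  have hmρ := fun j => measurable_ruleHit h_rule.measurable_rule w j
  have hωf : ∀ j, Measurable fun ω => ruleHit w (f (U ω)) j fun j k => T j k ω := fun j =>
    (hmf j).comp (hU.prodMk hX)
  have hωρ : ∀ j, Measurable fun ω => ruleHit w (ρ (U ω)) j fun j k => T j k ω := fun j =>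
    (hmρ j).comp (hU.prodMk hX)
  have hD : ∀ j ω, |ruleHit w (ρ (U ω)) (j + 1) (fun j k => T j k ω) -
      ruleHit w (f (U ω)) (j + 1) fun j k => T j k ω| ≤ 1 := fun j ω =>
    abs_sub_le_of_nonneg_of_le (ruleHit_nonneg _ _ _ _) (ruleHit_le_one _ _ _ _)
      (ruleHit_nonneg _ _ _ _) (ruleHit_le_one _ _ _ _)
  have habs : ∀ (f : ℝ → History n → Finset (Fin n)) j x, |ruleHit w f j x| ≤ 1 := fun f j x => by
    rw [abs_of_nonneg (ruleHit_nonneg _ _ _ _)]; exact ruleHit_le_one _ _ _ _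
  have hint := fun (φ : Ω → ℝ) => integrable_exp_neg_mul_sum_mul (μ := μ) (f := φ)
    (fun j => (hωρ (j + 1)).sub (hωf (j + 1))) hD hs k
  have i1 := hint _ (hωρ (k + 1)) fun ω => habs _ _ _
  have i2 := hint _ (hωf (k + 1)) fun ω => habs _ _ _
  simp only [Pi.sub_apply] at i1 i2
  simp only [mul_sub _ (ruleHit w _ (k + 1) _)]
  rw [integral_sub i1 i2, sub_nonneg]
  have nn : ∀ (f' : E → ℝ → History n → Finset (Fin n)) ω,
      0 ≤ Real.exp (-(s * ∑ j ∈ Finset.range k,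
        (ruleHit w (ρ (U ω)) (j + 1) (fun j k => T j k ω) -
          ruleHit w (f (U ω)) (j + 1) fun j k => T j k ω))) *
        ruleHit w (f' (U ω)) (k + 1) fun j k => T j k ω := fun f' ω =>
    mul_nonneg (Real.exp_pos _).le (ruleHit_nonneg _ _ _ _)
  rw [← ENNReal.ofReal_le_ofReal_iff (integral_nonneg (nn ρ)),
    ofReal_integral_eq_lintegral_ofReal i1 (ae_of_all _ (nn ρ)),
    ofReal_integral_eq_lintegral_ofReal i2 (ae_of_all _ (nn f))]
  simp only [ENNReal.ofReal_mul (Real.exp_pos _).le]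
  refine lintegral_hit_le hT h_indep hadm h_reg h_rule hf hcard k
    (Z := fun q => ENNReal.ofReal (Real.exp (-(s * ∑ j ∈ Finset.range k,
      (ruleHit w (ρ q.1) (j + 1) q.2 - ruleHit w (f q.1) (j + 1) q.2))))) ?_ ?_
  · have : Measurable fun q : E × EpochPath n => ∑ j ∈ Finset.range k,
        (ruleHit w (ρ q.1) (j + 1) q.2 - ruleHit w (f q.1) (j + 1) q.2) :=
      Finset.measurable_fun_sum _ fun j _ => (hmρ (j + 1)).sub (hmf (j + 1))
    exact ENNReal.measurable_ofReal.comp (Real.measurable_exp.comp (this.const_mul s).neg)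
  · intro e l x y hx h
    have : ∀ j ∈ Finset.range k, ruleHit w (ρ e) (j + 1) y - ruleHit w (f e) (j + 1) y =
        ruleHit w (ρ e) (j + 1) x - ruleHit w (f e) (j + 1) x := fun j hj => by
      rw [h.hit_eq hx (ρ e) (Finset.mem_range.1 hj), h.hit_eq hx (f e) (Finset.mem_range.1 hj)]
    simp only [Finset.sum_congr rfl this]

theorem ae_liminf_hitRatio_sub_nonneg (hT : ∀ i k, Measurable (T i k))
    (h_indep : iIndepFun (fun (i : Fin n) (ω : Ω) (k : ℤ) => T i k ω) μ)
    (hadm : ∀ᵐ ω ∂μ, IsAdmissiblePath (fun j k => T j k ω))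
    (h_reg : ∀ i, IsRegularProcess w μ T i) {B : ℕ} {ρ : E → ℝ → History n → Finset (Fin n)}
    (h_rule : IsHazardRateRule w μ T B U ρ) {f : E → ℝ → History n → Finset (Fin n)}
    (hf : ∀ S : Finset (Fin n), MeasurableSet {p : E × ℝ × History n | f p.1 p.2.1 p.2.2 = S})
    (hcard : ∀ e t h, (f e t h).card = B) :
    ∀ᵐ ω ∂μ, 0 ≤ liminf (fun K : ℕ => hitRatio T (ruleContent U ρ w T) K ω -
      hitRatio T (ruleContent U f w T) K ω) atTop := by
  simp only [hitRatio_sub_eq, hit_eq_ruleHit]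
  rcases isEmpty_or_nonempty (Fin n) with hn | hn
  · have h0 : ∀ (f : ℝ → History n → Finset (Fin n)) k x, ruleHit w f k x = 0 := fun f k x =>
      if_neg fun ⟨i, _⟩ => hn.elim i
    simp [h0]
  have hX := measurable_path hT
  have hU := h_rule.measurable_tie
  refine ae_liminf_average_nonneg (fun j => ?_) (fun j ω => ?_) fun s hs k =>
    integral_exp_neg_mul_hit_sub_nonneg hT h_indep hadm h_reg h_rule hf hcard hs k
  · exact ((measurable_ruleHit h_rule.measurable_rule w (j + 1)).comp (hU.prodMk hX)).sub
      ((measurable_ruleHit hf w (j + 1)).comp (hU.prodMk hX))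
  · exact abs_sub_le_of_nonneg_of_le (ruleHit_nonneg _ _ _ _) (ruleHit_le_one _ _ _ _)
      (ruleHit_nonneg _ _ _ _) (ruleHit_le_one _ _ _ _)

end LongRun

theorem mainTheorem1 {Ω : Type*} [MeasurableSpace Ω] (μ : Measure Ω) [IsProbabilityMeasure μ]
    (n B : ℕ) (T : Fin n → ℤ → Ω → ℝ)
    (hT_meas : ∀ i k, Measurable (T i k))
    (hT_mono : ∀ᵐ ω ∂μ, ∀ i, StrictMono (fun k : ℤ => T i k ω))
    (hT_zero : ∀ᵐ ω ∂μ, ∀ i, T i 0 ω ≤ 0 ∧ 0 < T i 1 ω)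
    (h_stat : ∀ i, IsStationaryErgodic μ (interRequest T i))
    (h_mean : ∀ i k, Integrable (interRequest T i k) μ)
    (h_indep : iIndepFun (fun (i : Fin n) (ω : Ω) (k : ℤ) => T i k ω) μ)
    (w : HistoryWindow)
    (h_reg : ∀ i, IsRegularProcess w μ T i)
    {E : Type*} [MeasurableSpace E] (U : Ω → E) (ρ : E → ℝ → History n → Finset (Fin n))
    (h_rule : IsHazardRateRule w μ T B U ρ)
    (π : CachingPolicy n B) :
    (∀ hHR hπ : ℝ,
      HasStationaryHitProb μ T (ruleContent U ρ w T) hHR →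
      HasStationaryHitProb μ T (π.content w T) hπ →
      hπ ≤ hHR) ∧
    (∀ᵐ ω ∂μ, 0 ≤ liminf
      (fun K : ℕ => hitRatio T (ruleContent U ρ w T) K ω - hitRatio T (π.content w T) K ω)
      atTop) := by
  have hadm : ∀ᵐ ω ∂μ, IsAdmissiblePath (fun j k => T j k ω) := by
    filter_upwards [hT_mono, hT_zero] with ω h1 h2 i
    exact ⟨(h2 i).1, (h2 i).2, (h1 i).comp Nat.strictMono_cast⟩
  have key : ∀ᵐ ω ∂μ, 0 ≤ liminf (fun K : ℕ =>
      hitRatio T (ruleContent U ρ w T) K ω - hitRatio T (π.content w T) K ω) atTop :=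
    ae_liminf_hitRatio_sub_nonneg (f := fun _ => π.cached) hT_meas h_indep hadm h_reg h_rule
      (fun S => measurable_snd (π.measurable_cached S)) fun _ => π.card_cached
  refine ⟨fun hHR hπ h1 h2 => ?_, key⟩
  obtain ⟨ω, hω, hω1, hω2⟩ := (key.and (h1.and h2)).exists
  rw [(hω1.sub hω2).liminf_eq] at hω
  linarith
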